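/- **Theorem.** Conventions. A *topological structure* is a compact zero-dimensional (Hausdorff) second-countable space with two closed binary relations $R,S$. An *epimorphism* $\phi:B\to A$ of topological structures is a continuous surjection such that, for each $Q\in\{R,S\}$ and all $x_1,x_2\in A$, $Q^A(x_1,x_2)$ holds if and only if there are $y_1,y_2\in B$ with $\phi(y_1)=x_1$, $\phi(y_2)=x_2$ and $Q^B(y_1,y_2)$. An *isomorphism* is a bijective epimorphism. A *fan* is an acyclic connected simple graph with a distinguished vertex, the root, all of whose vertices other than the root have degree at most $2$. On a fan put $s\preceq t$ if $s$ lies on the path from the root to $t$; a *branch* is a maximal chain of $\preceq$, and its height is its number of vertices minus one. Let $\mathcal F_<$ be the family of all structures $(A,R^A,S^A)$ (with the discrete topology) where $A$ is the vertex set of a finite fan all of whose branches have the same height, $R^A(s,t)$ holds if and only if $s=t$ or $t$ is an immediate successor of $s$ for $\preceq$, and for some ordering $a_1<\dots<a_n$ of the branches, $S^A(x,y)$ holds if and only if $x\in a_i$ and $y\in a_j$ for some $i\le j$. A *projective Fraïssé limit* of $\mathcal F_<$ is a topological structure $\mathbb L_<$ such that (L1) for every $A\in\mathcal F_<$ there is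 an epimorphism $\mathbb L_<\to A$; (L2) for every finite discrete space $X$ and continuous $f:\mathbb L_<\to X$ there are $A\in\mathcal F_<$, an epimorphism $\phi:\mathbb L_<\to A$ and a map $f_0:A\to X$ with $f=f_0\circ\phi$; (L3) for every $A\in\mathcal F_<$ and epimorphisms $\phi_1,\phi_2:\mathbb L_<\to A$ there is an isomorphism $\psi:\mathbb L_<\to\mathbb L_<$ with $\phi_2=\phi_1\circ\psi$. A topological group $G$ is *extremely amenable* if every continuous action $G\times X\to X$ on a non-empty compact Hausdorff space $X$ has a fixed point. Claim. A projective Fraïssé limit of $\mathcal F_<$ exists, and for every projective Fraïssé limit $\mathbb L_<$ of $\mathcal F_<$ the group $\mathrm{Aut}(\mathbb L_<)$ of all isomorphisms $\mathbb L_<\to\mathbb L_<$, with the compact-open topology, is extremely amenable. -/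

import Mathlib

universe u v

/-- A topological structure in the language `{R, S}` with two binary relation symbols: a compact
zero-dimensional second-countable space with two closed binary relations. For compact Hausdorff
spaces, zero-dimensional and totally disconnected mean the same. -/
structure TopStructure where
  carrier : Type u
  [topology : TopologicalSpace carrier]
  [compact : CompactSpace carrier]
  [hausdorff : T2Space carrier]
  [totallyDisconnected : TotallyDisconnectedSpace carrier]
  [secondCountable : SecondCountableTopology carrier]
  R : carrier → carrier → Prop
  S : carrier → carrier → Prop
  isClosed_R : IsClosed {p : carrier × carrier | R p.1 p.2}
  isClosed_S : IsClosed {p : carrier × carrier | S p.1 p.2}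

namespace TopStructure

instance : CoeSort TopStructure.{u} (Type u) := ⟨TopStructure.carrier⟩

attribute [instance] topology compact hausdorff totallyDisconnected secondCountable

/-- Epimorphisms of topological structures. -/
structure IsEpi {B : TopStructure.{u}} {A : TopStructure.{v}} (φ : B → A) : Prop where
  continuous : Continuous φ
  surjective : Function.Surjective φ
  R_iff : ∀ x₁ x₂ : A, A.R x₁ x₂ ↔ ∃ y₁ y₂ : B, φ y₁ = x₁ ∧ φ y₂ = x₂ ∧ B.R y₁ y₂
  S_iff : ∀ x₁ x₂ : A, A.S x₁ x₂ ↔ ∃ y₁ y₂ : B, φ y₁ = x₁ ∧ φ y₂ = x₂ ∧ B.S y₁ y₂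

/-- Isomorphisms are bijective epimorphisms. -/
def IsIso {B : TopStructure.{u}} {A : TopStructure.{v}} (φ : B → A) : Prop :=
  IsEpi φ ∧ Function.Bijective φ

/-- `L` is a projective Fraïssé limit of the family `G` (of finite structures): projective
universality, factorization of continuous maps to finite discrete spaces, and projective
ultrahomogeneity. -/
structure IsProjFraisseLimit (G : Set TopStructure.{0}) (L : TopStructure.{u}) : Prop where
  universal : ∀ A ∈ G, ∃ φ : L → A, IsEpi φ
  factor : ∀ (X : Type) [TopologicalSpace X] [DiscreteTopology X] [Finite X] (f : L → X),
    Continuous f → ∃ A ∈ G, ∃ φ : L → A, IsEpi φ ∧ ∃ f₀ : A → X, f = f₀ ∘ φ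
  ultrahomogeneous : ∀ A ∈ G, ∀ φ₁ φ₂ : L → A, IsEpi φ₁ → IsEpi φ₂ →
    ∃ ψ : L → L, IsIso ψ ∧ φ₂ = φ₁ ∘ ψ

theorem isEpi_id (L : TopStructure.{u}) : IsEpi (id : L → L) where
  continuous := continuous_id
  surjective := Function.surjective_id
  R_iff x₁ x₂ := by simp
  S_iff x₁ x₂ := by simp

theorem IsEpi.map_R_iff {L : TopStructure.{u}} {h : L ≃ₜ L} (hh : IsEpi h) (x y : L) :
    L.R (h x) (h y) ↔ L.R x y := by
  rw [hh.R_iff]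
  constructor
  · rintro ⟨y₁, y₂, h₁, h₂, hR⟩
    rwa [h.injective h₁, h.injective h₂] at hR
  · exact fun hR => ⟨x, y, rfl, rfl, hR⟩

theorem IsEpi.map_S_iff {L : TopStructure.{u}} {h : L ≃ₜ L} (hh : IsEpi h) (x y : L) :
    L.S (h x) (h y) ↔ L.S x y := by
  rw [hh.S_iff]
  constructor
  · rintro ⟨y₁, y₂, h₁, h₂, hS⟩
    rwa [h.injective h₁, h.injective h₂] at hS
  · exact fun hS => ⟨x, y, rfl, rfl, hS⟩

theorem isEpi_of_map_iff {L : TopStructure.{u}} {h : L ≃ₜ L}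
    (hR : ∀ x y : L, L.R (h x) (h y) ↔ L.R x y) (hS : ∀ x y : L, L.S (h x) (h y) ↔ L.S x y) :
    IsEpi h where
  continuous := h.continuous
  surjective := h.surjective
  R_iff x₁ x₂ := by
    constructor
    · intro hx
      refine ⟨h.symm x₁, h.symm x₂, by simp, by simp, ?_⟩
      rw [← hR]
      simpa using hx
    · rintro ⟨y₁, y₂, rfl, rfl, hy⟩
      exact (hR _ _).2 hy
  S_iff x₁ x₂ := by
    constructor
    · intro hx
      refine ⟨h.symm x₁, h.symm x₂, by simp, by simp, ?_⟩
      rw [← hS]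
      simpa using hx
    · rintro ⟨y₁, y₂, rfl, rfl, hy⟩
      exact (hS _ _).2 hy

/-- The automorphism group of a topological structure: the self-homeomorphisms that are
isomorphisms of the structure. -/
def Aut (L : TopStructure.{u}) : Subgroup (L ≃ₜ L) where
  carrier := {h | IsIso h}
  one_mem' := ⟨isEpi_id L, Function.bijective_id⟩
  mul_mem' := by
    intro a b ha hb
    exact ⟨isEpi_of_map_iff
      (fun x y => (ha.1.map_R_iff (b x) (b y)).trans (hb.1.map_R_iff x y))
      (fun x y => (ha.1.map_S_iff (b x) (b y)).trans (hb.1.map_S_iff x y)),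
      (a * b).bijective⟩
  inv_mem' := by
    intro a ha
    refine ⟨isEpi_of_map_iff (fun x y => ?_) (fun x y => ?_), (a⁻¹).bijective⟩
    · rw [← ha.1.map_R_iff]; simp
    · rw [← ha.1.map_S_iff]; simp

/-- An automorphism as a continuous map. -/
def Aut.toContinuousMap {L : TopStructure.{u}} (h : L.Aut) : C(L, L) :=
  ⟨h.1, h.1.continuous⟩

/-- The compact-open topology on the automorphism group. -/
instance (L : TopStructure.{u}) : TopologicalSpace L.Aut :=
  TopologicalSpace.induced Aut.toContinuousMap ContinuousMap.compactOpen

/-- The automorphism group with the compact-open topology is a topological group. -/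
instance (L : TopStructure.{u}) : IsTopologicalGroup L.Aut where
  continuous_mul := by
    rw [continuous_induced_rng]
    have h : Continuous (Aut.toContinuousMap (L := L)) := continuous_induced_dom
    exact (h.comp continuous_fst).compCM (h.comp continuous_snd)
  continuous_inv := by
    rw [continuous_induced_rng, ContinuousMap.continuous_compactOpen]
    intro K hK U hU
    have h : {g : L.Aut | Set.MapsTo (Aut.toContinuousMap g⁻¹) K U}
        = Aut.toContinuousMap ⁻¹' {f : C(L, L) | Set.MapsTo f Uᶜ Kᶜ} := by
      ext g
      constructor
      · intro hg x hx hxK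
        apply hx
        have := hg hxK
        have h2 : Aut.toContinuousMap g⁻¹ (Aut.toContinuousMap g x) = x :=
          g.1.symm_apply_apply x
        rwa [h2] at this
      · intro hg x hx
        by_contra hxU
        have h2 : Aut.toContinuousMap g (Aut.toContinuousMap g⁻¹ x) = x :=
          g.1.apply_symm_apply x
        exact hg hxU (by rwa [h2])
    exact h ▸ (ContinuousMap.isOpen_setOfPred_mapsTo hU.isClosed_compl.isCompact
      hK.isClosed.isOpen_compl).preimage continuous_induced_dom

end TopStructure

/-- A topological group is extremely amenable if every continuous action of it on a non-empty
compact Hausdorff space has a fixed point. -/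
def ExtremelyAmenable (G : Type u) [Group G] [TopologicalSpace G] [IsTopologicalGroup G] : Prop :=
  ∀ (X : Type v) [TopologicalSpace X] [CompactSpace X] [T2Space X] [Nonempty X]
    [MulAction G X] [ContinuousSMul G X], ∃ x : X, ∀ g : G, g • x = x

namespace Fan

variable {V : Type u}

/-- A fan: an acyclic connected simple graph with a root, all of whose vertices other than the root
have degree at most `2`. (The loops enter only through the reflexivity of the relation `R`.) -/
structure IsFan (T : SimpleGraph V) (r : V) : Prop where
  isTree : T.IsTree
  degree_le : ∀ t, t ≠ r → (T.neighborSet t).encard ≤ 2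

/-- The tree order: `s` lies on the path connecting the root and `t`. -/
def TreeLE (T : SimpleGraph V) (r s t : V) : Prop :=
  ∃ p : T.Walk r t, p.IsPath ∧ s ∈ p.support

/-- `t` is an immediate successor of `s`. -/
def ImmSucc (T : SimpleGraph V) (r s t : V) : Prop :=
  TreeLE T r s t ∧ s ≠ t ∧ ¬ ∃ p, p ≠ s ∧ p ≠ t ∧ TreeLE T r s p ∧ TreeLE T r p t

/-- A branch is a maximal chain of the tree order. -/
def IsBranch (T : SimpleGraph V) (r : V) (b : Set V) : Prop :=
  IsMaxChain (TreeLE T r) b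

/-- The class of ordered fans: finite fans all of whose branches have the same height (a branch of
height `k` has `k + 1` vertices), with `R s t` if `s = t` or `t` is an immediate successor of `s`,
and with `S x y`, for some ordering `a 0 < a 1 < ...` of the branches, if `x ∈ a i` and `y ∈ a j`
for some `i ≤ j`. The topology of a finite Hausdorff space is discrete. -/
def orderedFans : Set TopStructure.{0} :=
  {A | Finite A ∧ ∃ (T : SimpleGraph A) (r : A), IsFan T r ∧
    (∃ k : ℕ, ∀ b, IsBranch T r b → b.ncard = k + 1) ∧
    (∀ s t : A, A.R s t ↔ s = t ∨ ImmSucc T r s t) ∧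
    ∃ (n : ℕ) (a : Fin n ≃ {b : Set A // IsBranch T r b}),
      ∀ x y : A, A.S x y ↔ ∃ i j : Fin n, i ≤ j ∧ x ∈ (a i).1 ∧ y ∈ (a j).1}

end Fan

/-!
Every ordered fan is isomorphic to a standard fan `model k n`, which has `n` branches of height `k`
(`exists_equiv_model`, `model_mem_orderedFans`), so the limit is studied through the standard fans.
An epimorphism between standard fans places the branches of its source, in a nondecreasing way, on
the branches of its target, with a slow map on each of them, and covers every branch
(`IsPtEpi.exists_slow`, `isPtEpi_of_slow`).

The heart of the matter is the Ramsey property `exists_ramsey`: for given fans `C → A` there is a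
fan `B` such that, for every coloring of the epimorphisms `B → A` with finitely many colors, the
epimorphisms that factor through a suitable `B → C` have the same color. As in Gowers' theorem it
comes from idempotent ultrafilters. Slow maps act on words of slow maps by composition. There are
ultrafilters `q j` on the words with maximal value `j` such that each slow map `p` sends `q j` to
`q (p j)` and, below a given bound, `q i * q j = q (max i j)` (`exists_isCoherent_max`). Labelling
the letters of such words by the branches of `A` and multiplying the resulting ultrafilters over the
branches of `C`, one obtains an ultrafilter for each epimorphism `C → A`. By the product rule it is
always the same one, namely the product of the top ultrafilters over the branches of `A`
(`prod_eq_fullProd`). A generic word therefore gives a map to `C` on which the color is constant.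

Existence: the Ramsey property yields amalgamation (`exists_amalgam`). An inverse sequence of
standard fans that solves all amalgamation problems has a limit through which all continuous maps to
finite spaces factor and along which epimorphisms lift (`exists_isGenericLimit`). A back-and-forth
argument gives ultrahomogeneity (`IsGenericLimit.exists_isIso`).

Extreme amenability follows from the Ramsey property by the argument of Kechris, Pestov and
Todorcevic. The stabilizers of the epimorphisms onto standard fans form a neighborhood basis of the
identity (`IsStandardLimit.exists_stabilizer_subset`). Coloring such epimorphisms by the approximate
position of a translate of a point, one finds, for each finite set of automorphisms and each
entourage, a point that is moved within the entourage only
(`IsStandardLimit.exists_almost_fixed`). Compactness gives a fixed point.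
-/

namespace Fan

open Filter

/-! ### The semigroup of ultrafilters on a monoid -/

/-- The multiplication `Ultrafilter.mul` on the ultrafilters of a monoid, with the principal
ultrafilter at `1` as unit. -/
@[reducible] def ultrafilterMonoid (M : Type*) [Monoid M] : Monoid (Ultrafilter M) :=
  { Ultrafilter.semigroup with
    one := pure 1
    one_mul := fun U => Ultrafilter.coe_inj.mp <| Filter.ext' fun p => by
      change (∀ᶠ m in ((pure 1 : Ultrafilter M) : Filter M), ∀ᶠ m' in (U : Filter M), p (m * m')) ↔ _
      simp
    mul_one := fun U => Ultrafilter.coe_inj.mp <| Filter.ext' fun p => by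
      change (∀ᶠ m in (U : Filter M), ∀ᶠ m' in ((pure 1 : Ultrafilter M) : Filter M), p (m * m')) ↔ _
      simp }

attribute [local instance] ultrafilterMonoid

theorem eventually_mul_iff {M : Type*} [Monoid M] (U V : Ultrafilter M) (p : M → Prop) :
    (∀ᶠ m in ((U * V : Ultrafilter M) : Filter M), p m) ↔
      ∀ᶠ m in (U : Filter M), ∀ᶠ m' in (V : Filter M), p (m * m') :=
  Iff.rfl

theorem eventually_one_iff {M : Type*} [Monoid M] (p : M → Prop) :
    (∀ᶠ m in ((1 : Ultrafilter M) : Filter M), p m) ↔ p 1 := by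
  change (∀ᶠ m in ((pure 1 : Ultrafilter M) : Filter M), p m) ↔ _
  simp

theorem eventually_map_iff {M N : Type*} (f : M → N) (U : Ultrafilter M) (p : N → Prop) :
    (∀ᶠ m in ((U.map f : Ultrafilter N) : Filter N), p m) ↔ ∀ᶠ m in (U : Filter M), p (f m) :=
  Iff.rfl

theorem ultrafilter_ext {M : Type*} {U V : Ultrafilter M}
    (h : ∀ p : M → Prop, (∀ᶠ m in (U : Filter M), p m) ↔ ∀ᶠ m in (V : Filter M), p m) : U = V :=
  Ultrafilter.coe_inj.mp <| Filter.ext' h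

theorem map_mul_ultrafilter {M N : Type*} [Monoid M] [Monoid N] (f : M →* N)
    (U V : Ultrafilter M) : (U * V).map f = U.map f * V.map f :=
  ultrafilter_ext fun p => by
    simp only [eventually_map_iff, eventually_mul_iff, map_mul]

theorem map_one_ultrafilter {M N : Type*} [Monoid M] [Monoid N] (f : M →* N) :
    (1 : Ultrafilter M).map f = 1 :=
  ultrafilter_ext fun p => by
    simp only [eventually_map_iff, eventually_one_iff, map_one]

theorem map_list_prod_ultrafilter {M N : Type*} [Monoid M] [Monoid N] (f : M →* N)
    (l : List (Ultrafilter M)) : l.prod.map f = (l.map (Ultrafilter.map f)).prod := by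
  induction l with
  | nil => simp [map_one_ultrafilter]
  | cons U l ih => simp [map_mul_ultrafilter, ih]

theorem map_congr_ultrafilter {M N : Type*} {f g : M → N} {U : Ultrafilter M}
    (h : ∀ᶠ m in (U : Filter M), f m = g m) : U.map f = U.map g :=
  ultrafilter_ext fun p => by
    simp only [eventually_map_iff]
    exact eventually_congr (h.mono fun m hm => by rw [hm])

theorem continuous_mul_const_ultrafilter {M : Type*} [Monoid M] (V : Ultrafilter M) :
    Continuous (· * V) :=
  Ultrafilter.continuous_mul_left V

theorem continuous_map_ultrafilter {M N : Type*} (f : M → N) :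
    Continuous (Ultrafilter.map f : Ultrafilter M → Ultrafilter N) :=
  ultrafilterBasis_is_basis.continuous_iff.2 <| Set.forall_mem_range.mpr fun s =>
    ultrafilter_isOpen_basic (f ⁻¹' s)

/-! ### Slow maps and words -/

/-- A slow map: it starts at `0` and each step is `0` or `1`. These are the maps between branches,
a branch being identified with an initial segment of `ℕ`. -/
structure IsSlow (p : ℕ → ℕ) : Prop where
  zero : p 0 = 0
  succ : ∀ t, p (t + 1) = p t ∨ p (t + 1) = p t + 1

namespace IsSlow

theorem monotone {p : ℕ → ℕ} (hp : IsSlow p) : Monotone p :=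
  monotone_nat_of_le_succ fun t => by rcases hp.succ t with h | h <;> omega

theorem le_self {p : ℕ → ℕ} (hp : IsSlow p) (t : ℕ) : p t ≤ t := by
  induction t with
  | zero => exact hp.zero.le
  | succ t ih => rcases hp.succ t with h | h <;> omega

theorem exists_eq_of_le {p : ℕ → ℕ} (hp : IsSlow p) {a N : ℕ} (h : a ≤ p N) :
    ∃ t ≤ N, p t = a := by
  induction N with
  | zero => exact ⟨0, le_rfl, by have := hp.zero; omega⟩
  | succ N ih =>
    rcases hp.succ N with h' | h'
    · obtain ⟨t, ht, rfl⟩ := ih (h' ▸ h)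
      exact ⟨t, by omega, rfl⟩
    · by_cases ha : a = p (N + 1)
      · exact ⟨N + 1, le_rfl, ha.symm⟩
      · obtain ⟨t, ht, rfl⟩ := ih (by omega)
        exact ⟨t, by omega, rfl⟩

theorem exists_step_of_lt {p : ℕ → ℕ} (hp : IsSlow p) {a N : ℕ} (h : a < p N) :
    ∃ t < N, p t = a ∧ p (t + 1) = a + 1 := by
  induction N with
  | zero => have := hp.zero; omega
  | succ N ih =>
    by_cases ha : a < p N
    · obtain ⟨t, ht, h1⟩ := ih ha
      exact ⟨t, by omega, h1⟩
    · exact ⟨N, by omega, by rcases hp.succ N with h' | h' <;> omega⟩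

theorem min (k : ℕ) : IsSlow fun t => min t k where
  zero := by simp
  succ t := by omega

end IsSlow

/-- Words whose letters are maps `ℕ → ℕ`, in the applications slow maps. -/
abbrev Word := FreeMonoid (ℕ → ℕ)

/-- The action of a map on words by composition, letter by letter. -/
def subst (p : ℕ → ℕ) : Word →* Word := FreeMonoid.map fun σ => p ∘ σ

/-- The words of level `j`: the letters are slow maps bounded by `j`, and one of them attains the
value `j`. -/
def levelWords (j : ℕ) : Set Word :=
  {w | (∀ σ ∈ w, IsSlow σ ∧ ∀ t, σ t ≤ j) ∧ ∃ σ ∈ w, ∃ t, σ t = j}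

theorem mul_mem_levelWords {j : ℕ} {w w' : Word} (hw : w ∈ levelWords j)
    (hw' : w' ∈ levelWords j) : w * w' ∈ levelWords j := by
  refine ⟨fun σ hσ => ?_, ?_⟩
  · rcases FreeMonoid.mem_mul.1 hσ with h | h
    exacts [hw.1 σ h, hw'.1 σ h]
  · obtain ⟨σ, hσ, h⟩ := hw.2
    exact ⟨σ, FreeMonoid.mem_mul.2 (Or.inl hσ), h⟩

theorem mul_mem_levelWords_max {i j : ℕ} {w w' : Word} (hw : w ∈ levelWords i)
    (hw' : w' ∈ levelWords j) : w * w' ∈ levelWords (max i j) := by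
  refine ⟨fun σ hσ => ?_, ?_⟩
  · rcases FreeMonoid.mem_mul.1 hσ with h | h
    · exact ⟨(hw.1 σ h).1, fun t => ((hw.1 σ h).2 t).trans (le_max_left _ _)⟩
    · exact ⟨(hw'.1 σ h).1, fun t => ((hw'.1 σ h).2 t).trans (le_max_right _ _)⟩
  · rcases le_total i j with h | h
    · obtain ⟨σ, hσ, t, ht⟩ := hw'.2
      exact ⟨σ, FreeMonoid.mem_mul.2 (Or.inr hσ), t, by rw [max_eq_right h, ht]⟩
    · obtain ⟨σ, hσ, t, ht⟩ := hw.2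
      exact ⟨σ, FreeMonoid.mem_mul.2 (Or.inl hσ), t, by rw [max_eq_left h, ht]⟩

/-! ### Coherent sequences of ultrafilters -/

/-- A sequence of ultrafilters `y j` on the words of level `j` is coherent if every slow map `p`
sends `y j` to `y (p j)`. -/
structure IsCoherent (y : ℕ → Ultrafilter Word) : Prop where
  level : ∀ j, ∀ᶠ w in (y j : Filter Word), w ∈ levelWords j
  map_subst : ∀ p, IsSlow p → ∀ j, (y j).map (subst p) = y (p j)

/-- The map that follows `σ` before `N` and has the value `j` from `N` on. -/
def addJump (j : ℕ) (σ : ℕ → ℕ) (N : ℕ) : ℕ → ℕ := fun t => if t < N then σ t else j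

/-- The ultrafilters of coherent letters: the places of the `j` jumps are chosen one after the
other along a fixed nonprincipal ultrafilter on `ℕ`. -/
noncomputable def letterUltrafilter : ℕ → Ultrafilter (ℕ → ℕ)
  | 0 => pure 0
  | j + 1 => (letterUltrafilter j).bind fun σ => (hyperfilter ℕ).map (addJump (j + 1) σ)

theorem eventually_letterUltrafilter_succ (j : ℕ) (p : (ℕ → ℕ) → Prop) :
    (∀ᶠ σ in (letterUltrafilter (j + 1) : Filter (ℕ → ℕ)), p σ) ↔
      ∀ᶠ σ in (letterUltrafilter j : Filter (ℕ → ℕ)), ∀ᶠ N in (hyperfilter ℕ : Filter ℕ),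
        p (addJump (j + 1) σ N) :=
  Iff.rfl

theorem eventually_hyperfilter_ge (M : ℕ) : ∀ᶠ N in (hyperfilter ℕ : Filter ℕ), M ≤ N :=
  (Nat.hyperfilter_le_atTop) (eventually_ge_atTop M)

theorem eventually_letterUltrafilter (j : ℕ) :
    ∀ᶠ σ in (letterUltrafilter j : Filter (ℕ → ℕ)),
      IsSlow σ ∧ (∀ t, σ t ≤ j) ∧ ∃ M, ∀ t ≥ M, σ t = j := by
  induction j with
  | zero =>
    change ∀ᶠ σ in ((pure 0 : Ultrafilter (ℕ → ℕ)) : Filter (ℕ → ℕ)), _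
    simp only [Ultrafilter.coe_pure, eventually_pure]
    exact ⟨⟨rfl, fun _ => Or.inl rfl⟩, fun _ => le_rfl, 0, fun _ _ => rfl⟩
  | succ j ih =>
    rw [eventually_letterUltrafilter_succ]
    filter_upwards [ih] with σ ⟨h1, h2, M, hM⟩
    filter_upwards [eventually_hyperfilter_ge (M + 1)] with N hN
    refine ⟨⟨?_, fun t => ?_⟩, fun t => ?_, N, fun t ht => ?_⟩
    · rw [addJump, if_pos (by omega), h1.zero]
    · unfold addJump
      rcases lt_trichotomy (t + 1) N with h | h | h
      · rw [if_pos h, if_pos (by omega)]; exact h1.succ t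
      · rw [if_neg (by omega), if_pos (by omega), hM t (by omega)]; right; rfl
      · rw [if_neg (by omega), if_neg (by omega)]; left; rfl
    · unfold addJump
      split_ifs
      · exact (h2 t).trans (by omega)
      · exact le_rfl
    · rw [addJump, if_neg (by omega)]

theorem map_letterUltrafilter {p : ℕ → ℕ} (hp : IsSlow p) (j : ℕ) :
    (letterUltrafilter j).map (fun σ => p ∘ σ) = letterUltrafilter (p j) := by
  induction j with
  | zero =>
    rw [hp.zero]
    refine ultrafilter_ext fun s => ?_
    rw [eventually_map_iff]
    change (∀ᶠ σ in ((pure 0 : Ultrafilter (ℕ → ℕ)) : Filter (ℕ → ℕ)), _) ↔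
      (∀ᶠ σ in ((pure 0 : Ultrafilter (ℕ → ℕ)) : Filter (ℕ → ℕ)), _)
    simp only [Ultrafilter.coe_pure, eventually_pure]
    rw [show p ∘ (0 : ℕ → ℕ) = 0 from funext fun _ => hp.zero]
  | succ j ih =>
    refine ultrafilter_ext fun s => ?_
    rw [eventually_map_iff, eventually_letterUltrafilter_succ]
    rcases hp.succ j with h | h
    · rw [h, ← ih, eventually_map_iff]
      refine eventually_congr ((eventually_letterUltrafilter j).mono fun σ ⟨_, _, M, hM⟩ => ?_)
      -- `p` does not see a jump from `j` to `j + 1` that is made after `σ` has reached `j`.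
      have : ∀ᶠ N in (hyperfilter ℕ : Filter ℕ), p ∘ addJump (j + 1) σ N = p ∘ σ := by
        filter_upwards [eventually_hyperfilter_ge M] with N hN
        funext t
        simp only [Function.comp, addJump]
        split_ifs with ht
        · rfl
        · rw [h, hM t (by omega)]
      rw [eventually_congr (this.mono fun N hN => by rw [hN]), eventually_const]
    · rw [h, eventually_letterUltrafilter_succ, ← ih, eventually_map_iff]
      refine eventually_congr (Eventually.of_forall fun σ => eventually_congr
        (Eventually.of_forall fun N => ?_))
      rw [show p ∘ addJump (j + 1) σ N = addJump (p j + 1) (p ∘ σ) N from ?_]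
      funext t
      simp only [Function.comp, addJump]
      split_ifs with ht
      · rfl
      · exact h

theorem exists_isCoherent : ∃ y, IsCoherent y := by
  refine ⟨fun j => (letterUltrafilter j).map FreeMonoid.of, fun j => ?_, fun p hp j => ?_⟩
  · rw [eventually_map_iff]
    filter_upwards [eventually_letterUltrafilter j] with σ ⟨h1, h2, M, hM⟩
    refine ⟨fun τ hτ => ?_, σ, FreeMonoid.mem_of.2 rfl, M, hM M le_rfl⟩
    rw [FreeMonoid.mem_of.1 hτ]
    exact ⟨h1, h2⟩
  · rw [← map_letterUltrafilter hp]
    refine ultrafilter_ext fun s => ?_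
    simp only [eventually_map_iff, subst, FreeMonoid.map_of]

theorem IsCoherent.mul {y z : ℕ → Ultrafilter Word} (hy : IsCoherent y) (hz : IsCoherent z) :
    IsCoherent (y * z) where
  level j := by
    rw [Pi.mul_apply, eventually_mul_iff]
    filter_upwards [hy.level j] with w hw
    filter_upwards [hz.level j] with w' hw' using mul_mem_levelWords hw hw'
  map_subst p hp j := by
    rw [Pi.mul_apply, map_mul_ultrafilter, hy.map_subst p hp, hz.map_subst p hp, Pi.mul_apply]

theorem isClosed_isCoherent : IsClosed {y | IsCoherent y} := by
  have : {y | IsCoherent y} = (⋂ j, {y : ℕ → Ultrafilter Word | levelWords j ∈ y j}) ∩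
      ⋂ p, ⋂ (_ : IsSlow p), ⋂ j, {y | (y j).map (subst p) = y (p j)} := by
    ext y
    simp only [Set.mem_inter_iff, Set.mem_iInter, Set.mem_ofPred_eq]
    exact ⟨fun h => ⟨h.level, h.map_subst⟩, fun h => ⟨h.1, h.2⟩⟩
  rw [this]
  refine IsClosed.inter (isClosed_iInter fun j => ?_) (isClosed_iInter fun p =>
    isClosed_iInter fun _ => isClosed_iInter fun j => ?_)
  · exact (ultrafilter_isClosed_basic (levelWords j)).preimage
      (continuous_apply (A := fun _ : ℕ => Ultrafilter Word) j)
  · exact isClosed_eq ((continuous_map_ultrafilter _).comp (continuous_apply j))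
      (continuous_apply (p j))

/-- The product `y j * y (j - 1) * ⋯ * y 0`. -/
noncomputable def descProd (y : ℕ → Ultrafilter Word) : ℕ → Ultrafilter Word
  | 0 => y 0
  | j + 1 => y (j + 1) * descProd y j

/-- The product `y 0 * y 1 * ⋯ * y j`. -/
noncomputable def ascProd (y : ℕ → Ultrafilter Word) : ℕ → Ultrafilter Word
  | 0 => y 0
  | j + 1 => ascProd y j * y (j + 1)

section Products

variable {y : ℕ → Ultrafilter Word}

theorem mul_descProd_self (hyy : ∀ j, y j * y j = y j) (j : ℕ) :
    y j * descProd y j = descProd y j := by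
  cases j with
  | zero => exact hyy 0
  | succ j => rw [descProd, ← mul_assoc, hyy]

theorem ascProd_mul_self (hyy : ∀ j, y j * y j = y j) (j : ℕ) :
    ascProd y j * y j = ascProd y j := by
  cases j with
  | zero => exact hyy 0
  | succ j => rw [ascProd, mul_assoc, hyy]

/-- A slow map turns `y j * ⋯ * y 0` into `y (p j) * ⋯ * y 0` with repetitions, which idempotence
removes. -/
theorem isCoherent_descProd (hy : IsCoherent y) (hyy : ∀ j, y j * y j = y j) :
    IsCoherent (descProd y) where
  level j := by
    induction j with
    | zero => exact hy.level 0
    | succ j ih =>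
      rw [descProd, eventually_mul_iff]
      filter_upwards [hy.level (j + 1)] with w hw
      filter_upwards [ih] with w' hw'
      simpa using mul_mem_levelWords_max hw hw'
  map_subst p hp j := by
    induction j with
    | zero => rw [hp.zero, descProd, hy.map_subst p hp, hp.zero]
    | succ j ih =>
      rw [descProd, map_mul_ultrafilter, ih, hy.map_subst p hp]
      rcases hp.succ j with h | h
      · rw [h, mul_descProd_self hyy]
      · rw [h, descProd]

theorem isCoherent_ascProd (hy : IsCoherent y) (hyy : ∀ j, y j * y j = y j) :
    IsCoherent (ascProd y) where
  level j := by
    induction j with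
    | zero => exact hy.level 0
    | succ j ih =>
      rw [ascProd, eventually_mul_iff]
      filter_upwards [ih] with w hw
      filter_upwards [hy.level (j + 1)] with w' hw'
      simpa using mul_mem_levelWords_max hw hw'
  map_subst p hp j := by
    induction j with
    | zero => rw [hp.zero, ascProd, hy.map_subst p hp, hp.zero]
    | succ j ih =>
      rw [ascProd, map_mul_ultrafilter, ih, hy.map_subst p hp]
      rcases hp.succ j with h | h
      · rw [h, ascProd_mul_self hyy]
      · rw [h, ascProd]

theorem mul_descProd_of_lt {l j : ℕ} (hl : ∀ i < l, ∀ j, i ≤ j → y j * y i = y j) {i : ℕ}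
    (hi : i < l) (hij : i ≤ j) : y j * descProd y i = y j := by
  induction i with
  | zero => exact hl 0 hi j hij
  | succ i ih => rw [descProd, ← mul_assoc, hl _ hi j hij, ih (by omega) (by omega)]

end Products

/-- Coherent idempotents can be chosen such that the lower ones are absorbed on the right. In the
induction step the sequence `y j * ⋯ * y 0` absorbs one more level, and the coherent sequences with
this property and with the same lower terms form a compact semigroup, hence contain an
idempotent. -/
theorem exists_isCoherent_absorbing (l : ℕ) : ∃ y, IsCoherent y ∧ (∀ j, y j * y j = y j) ∧
    ∀ i < l, ∀ j, i ≤ j → y j * y i = y j := by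
  have hcont : ∀ r : ℕ → Ultrafilter Word, Continuous (· * r) := fun r =>
    continuous_pi fun j => (continuous_mul_const_ultrafilter (r j)).comp (continuous_apply j)
  induction l with
  | zero =>
    obtain ⟨y, hy, hyy⟩ := exists_idempotent_in_compact_subsemigroup hcont {y | IsCoherent y}
      exists_isCoherent isClosed_isCoherent.isCompact fun x hx z hz => hx.mul hz
    exact ⟨y, hy, fun j => congr_fun hyy j, fun i hi => absurd hi (Nat.not_lt_zero i)⟩
  | succ l ih =>
    obtain ⟨y, hy, hyy, hl⟩ := ih
    have hlow : ∀ i ≤ l, descProd y i = y i := by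
      intro i hi
      cases i with
      | zero => rfl
      | succ i => exact mul_descProd_of_lt hl (by omega) (by omega)
    have hdesc : ∀ j, l ≤ j → descProd y j * y l = descProd y j := by
      intro j hj
      induction j, hj using Nat.le_induction with
      | base => rw [hlow l le_rfl, hyy]
      | succ j hj ih => rw [descProd, mul_assoc, ih]
    have hdesc' : ∀ i ≤ l, ∀ j, i ≤ j → descProd y j * y i = descProd y j := by
      intro i hi j hij
      rcases le_or_gt l j with hj | hj
      · rcases hi.lt_or_eq with hi | rfl
        · rw [← hdesc j hj, mul_assoc, hl i hi l hi.le]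
        · exact hdesc j hj
      · rw [hlow j hj.le, hl i (by omega) j hij]
    set Z : Set (ℕ → Ultrafilter Word) :=
      {z | IsCoherent z ∧ (∀ i ≤ l, z i = y i) ∧ ∀ i ≤ l, ∀ j, i ≤ j → z j * y i = z j} with hZ
    have hcomp : IsCompact Z := by
      refine IsClosed.isCompact ?_
      simp only [hZ, Set.ofPred_and, Set.ofPred_forall]
      refine isClosed_isCoherent.inter (IsClosed.inter ?_ ?_)
      · exact isClosed_iInter fun i => isClosed_iInter fun _ =>
          isClosed_eq (continuous_apply i) continuous_const
      · exact isClosed_iInter fun i => isClosed_iInter fun _ => isClosed_iInter fun j =>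
          isClosed_iInter fun _ => isClosed_eq ((continuous_mul_const_ultrafilter (y i)).comp
            (continuous_apply j)) (continuous_apply j)
    have hmul : ∀ᵉ (z ∈ Z) (z' ∈ Z), z * z' ∈ Z := by
      rintro z ⟨hz, hz1, hz2⟩ z' ⟨hz', hz1', hz2'⟩
      refine ⟨hz.mul hz', fun i hi => ?_, fun i hi j hij => ?_⟩
      · rw [Pi.mul_apply, hz1 i hi, hz1' i hi, hyy]
      · rw [Pi.mul_apply, mul_assoc, hz2' i hi j hij]
    obtain ⟨z, ⟨hz, hzlow, hzl⟩, hzz⟩ := exists_idempotent_in_compact_subsemigroup hcont Z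
      ⟨descProd y, isCoherent_descProd hy hyy, hlow, hdesc'⟩ hcomp hmul
    refine ⟨z, hz, fun j => congr_fun hzz j, fun i hi j hij => ?_⟩
    rw [hzlow i (by omega), hzl i (by omega) j hij]

/-- The Gowers type sequence of ultrafilters: coherent, and any two terms with indices at most `l`
multiply to the one with the larger index. If `y` is coherent and absorbing, then `y 0 * ⋯ * y j`
is such a sequence. -/
theorem exists_isCoherent_max (l : ℕ) : ∃ q, IsCoherent q ∧
    ∀ i ≤ l, ∀ j ≤ l, q i * q j = q (max i j) := by
  obtain ⟨y, hy, hyy, hl⟩ := exists_isCoherent_absorbing (l + 1)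
  have hmul : ∀ i ≤ l, ∀ j, i ≤ j → ∀ a, a ≤ i → ascProd y j * y a = ascProd y j := by
    intro i hi j hij a ha
    cases j with
    | zero => exact hl a (by omega) 0 (by omega)
    | succ j => rw [ascProd, mul_assoc, hl a (by omega) (j + 1) (by omega)]
  have hright : ∀ i ≤ l, ∀ j, i ≤ j → ascProd y j * ascProd y i = ascProd y j := by
    intro i hi j hij
    have : ∀ a ≤ i, ascProd y j * ascProd y a = ascProd y j := by
      intro a ha
      induction a with
      | zero => exact hmul i hi j hij 0 (by omega)
      | succ a ih => rw [ascProd, ← mul_assoc, ih (by omega), hmul i hi j hij _ ha]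
    exact this i le_rfl
  have hleft : ∀ i ≤ l, ∀ j, i ≤ j → ascProd y i * ascProd y j = ascProd y j := by
    intro i hi j hij
    induction j, hij using Nat.le_induction with
    | base => exact hright i hi i le_rfl
    | succ j hj ih => rw [ascProd, ← mul_assoc, ih]
  refine ⟨ascProd y, isCoherent_ascProd hy hyy, fun i hi j hj => ?_⟩
  rcases le_total i j with h | h
  · rw [max_eq_right h, hleft i hi j h]
  · rw [max_eq_left h, hright j hj i h]

/-! ### The standard ordered fans and their epimorphisms -/

/-- The vertices of the standard fan with `n` branches of height `k`: the root, and the vertices at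
height `lev`, where `0 < lev ≤ k`, of the branch number `br < n`. The root gets branch number `0`. -/
@[ext] structure Pt (k n : ℕ) where
  /-- The index of the branch of a vertex, `0` for the root. -/
  br : ℕ
  /-- The height of a vertex. -/
  lev : ℕ
  prop : (br = 0 ∧ lev = 0) ∨ (br < n ∧ 0 < lev ∧ lev ≤ k)

namespace Pt

variable {k n : ℕ}

/-- The vertex at height `t` of the `i`-th branch. The value is the root if there is no such
vertex. -/
def pt (i t : ℕ) : Pt k n :=
  if h : i < n ∧ 0 < t ∧ t ≤ k then ⟨i, t, Or.inr h⟩ else ⟨0, 0, Or.inl ⟨rfl, rfl⟩⟩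

theorem lev_le (x : Pt k n) : x.lev ≤ k := by
  rcases x.prop with h | h <;> omega

theorem br_lt (hn : 0 < n) (x : Pt k n) : x.br < n := by
  rcases x.prop with h | h <;> omega

@[simp] theorem pt_zero (i : ℕ) : (pt i 0 : Pt k n) = pt 0 0 := by
  simp [pt]

@[simp] theorem lev_root : (pt 0 0 : Pt k n).lev = 0 := by
  simp [pt]

@[simp] theorem br_root : (pt 0 0 : Pt k n).br = 0 := by
  simp [pt]

theorem lev_pt {i t : ℕ} (hi : i < n) (ht : t ≤ k) : (pt i t : Pt k n).lev = t := by
  rcases Nat.eq_zero_or_pos t with rfl | h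
  · simp
  · simp [pt, hi, h, ht]

theorem br_pt {i t : ℕ} (hi : i < n) (ht : t ≤ k) (h0 : 0 < t) : (pt i t : Pt k n).br = i := by
  simp [pt, hi, h0, ht]

@[simp] theorem pt_br_lev (x : Pt k n) : pt x.br x.lev = x := by
  rcases x.prop with h | h
  · rw [h.1, h.2]
    exact Pt.ext (by rw [br_root, h.1]) (by rw [lev_root, h.2])
  · exact Pt.ext (br_pt h.1 h.2.2 h.2.1) (lev_pt h.1 h.2.2)

theorem eq_root {x : Pt k n} (hx : x.lev = 0) : x = pt 0 0 := by
  rw [← pt_br_lev x, hx, pt_zero]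

theorem exists_pt (hn : 0 < n) (x : Pt k n) : ∃ i < n, ∃ t ≤ k, x = pt i t :=
  ⟨x.br, x.br_lt hn, x.lev, x.lev_le, (pt_br_lev x).symm⟩

instance : Finite (Pt k n) := by
  refine Finite.of_injective (β := Fin (n + 1) × Fin (k + 1))
    (fun x => (⟨x.br, ?_⟩, ⟨x.lev, Nat.lt_succ_of_le x.lev_le⟩)) fun x y h => ?_
  · rcases x.prop with h | h <;> omega
  · simp only [Prod.mk.injEq, Fin.mk.injEq] at h
    exact Pt.ext h.1 h.2

instance : TopologicalSpace (Pt k n) := ⊥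

instance : DiscreteTopology (Pt k n) := ⟨rfl⟩

end Pt

open Pt

/-- The standard ordered fan with `n` branches of height `k`. -/
def model (k n : ℕ) : TopStructure.{0} where
  carrier := Pt k n
  R x y := x = y ∨ (y.lev = x.lev + 1 ∧ (x.lev = 0 ∨ x.br = y.br))
  S x y := x.lev = 0 ∨ y.lev = 0 ∨ x.br ≤ y.br
  isClosed_R := isClosed_discrete _
  isClosed_S := isClosed_discrete _

instance (k n : ℕ) : Finite (model k n) := inferInstanceAs (Finite (Pt k n))
instance (k n : ℕ) : DiscreteTopology (model k n) := inferInstanceAs (DiscreteTopology (Pt k n))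
instance (k n : ℕ) : Inhabited (model k n) := ⟨(pt 0 0 : Pt k n)⟩

/-- The relation `R` of the standard fan. -/
def Pt.R {k n : ℕ} (x y : Pt k n) : Prop := x = y ∨ (y.lev = x.lev + 1 ∧ (x.lev = 0 ∨ x.br = y.br))

/-- The relation `S` of the standard fan. -/
def Pt.S {k n : ℕ} (x y : Pt k n) : Prop := x.lev = 0 ∨ y.lev = 0 ∨ x.br ≤ y.br

/-- `IsEpi` between standard fans, for functions between the underlying types. -/
def IsPtEpi {N M k n : ℕ} (g : Pt N M → Pt k n) : Prop :=
  TopStructure.IsEpi (B := model N M) (A := model k n) g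

theorem isPtEpi_iff {N M k n : ℕ} (g : Pt N M → Pt k n) : IsPtEpi g ↔ Function.Surjective g ∧
    (∀ x₁ x₂, R x₁ x₂ ↔ ∃ y₁ y₂, g y₁ = x₁ ∧ g y₂ = x₂ ∧ R y₁ y₂) ∧
    (∀ x₁ x₂, S x₁ x₂ ↔ ∃ y₁ y₂, g y₁ = x₁ ∧ g y₂ = x₂ ∧ S y₁ y₂) :=
  ⟨fun h => ⟨h.surjective, h.R_iff, h.S_iff⟩,
    fun h => ⟨continuous_of_discreteTopology, h.1, h.2.1, h.2.2⟩⟩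

section Model

variable {k n : ℕ}

theorem R_pt_succ {i t : ℕ} (hi : i < n) (ht : t < k) :
    R (pt i t : Pt k n) (pt i (t + 1)) := by
  rw [R, lev_pt hi ht.le, lev_pt hi ht]
  refine Or.inr ⟨rfl, ?_⟩
  rcases Nat.eq_zero_or_pos t with h | h
  · exact Or.inl h
  · exact Or.inr (by rw [br_pt hi ht.le h, br_pt hi ht (by omega)])

/-- The `R`-predecessors of a vertex are the vertex itself and the vertex below it. -/
theorem R_pred {x y : Pt k n} (h : R x y) :
    x = pt y.br x.lev ∧ (y.lev = x.lev ∨ y.lev = x.lev + 1) := by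
  rcases h with rfl | ⟨h1, h2 | h2⟩
  · simp
  · refine ⟨?_, Or.inr h1⟩
    rw [h2, pt_zero]; exact eq_root h2
  · refine ⟨?_, Or.inr h1⟩
    rw [← h2, pt_br_lev]

theorem R_pt_pred {x : Pt k n} {i t : ℕ} (hi : i < n) (ht : t ≤ k) (h : R x (pt i t)) :
    x = pt i x.lev ∧ (t = x.lev ∨ t = x.lev + 1) := by
  obtain ⟨h1, h2⟩ := R_pred h
  rw [lev_pt hi ht] at h2
  refine ⟨?_, h2⟩
  rcases Nat.eq_zero_or_pos x.lev with h0 | h0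
  · rw [h0, pt_zero]; exact eq_root h0
  · rwa [br_pt hi ht (by omega)] at h1

theorem S_pt_pt {i j s t : ℕ} (hij : i ≤ j) (hi : i < n) (hj : j < n) (hs : s ≤ k) (ht : t ≤ k) :
    S (pt i s : Pt k n) (pt j t) := by
  rw [S, lev_pt hi hs, lev_pt hj ht]
  rcases Nat.eq_zero_or_pos s with h | h
  · exact Or.inl h
  rcases Nat.eq_zero_or_pos t with h' | h'
  · exact Or.inr (Or.inl h')
  · rw [br_pt hi hs h, br_pt hj ht h']; exact Or.inr (Or.inr hij)

end Model

/-- A nondecreasing placement of the branches of one fan on the branches of another one, with a slow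
map on each branch, is an epimorphism as soon as each branch is covered. -/
theorem isPtEpi_of_slow {N M k n : ℕ} {b : ℕ → ℕ} {σ : ℕ → ℕ → ℕ} (hn : 0 < n)
    (hslow : ∀ c, IsSlow (σ c)) (hle : ∀ c t, σ c t ≤ k) (hb : ∀ c, b c < n)
    (hmono : ∀ c c', c ≤ c' → (∃ t, σ c t ≠ 0) → (∃ t, σ c' t ≠ 0) → b c ≤ b c')
    (hfull : ∀ i < n, ∃ c < M, b c = i ∧ σ c N = k) :
    IsPtEpi fun x : Pt N M => (pt (b x.br) (σ x.br x.lev) : Pt k n) := by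
  have hM : 0 < M := by obtain ⟨c, hc, _⟩ := hfull 0 hn; omega
  have hval : ∀ c < M, ∀ t ≤ N,
      (pt (b (pt c t : Pt N M).br) (σ (pt c t : Pt N M).br (pt c t : Pt N M).lev) : Pt k n) =
        pt (b c) (σ c t) := by
    intro c hc t ht
    rcases Nat.eq_zero_or_pos t with rfl | h
    · simp only [pt_zero, lev_root, (hslow _).zero]
    · rw [br_pt hc ht h, lev_pt hc ht]
  have hlift : ∀ i < n, ∀ c, b c = i → σ c N = k → ∀ t ≤ k, ∃ s ≤ N, σ c s = t := by
    intro i hi c hbc hk t ht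
    exact (hslow c).exists_eq_of_le (by omega)
  have hsurj : Function.Surjective fun x : Pt N M => (pt (b x.br) (σ x.br x.lev) : Pt k n) := by
    intro x
    obtain ⟨i, hi, t, ht, rfl⟩ := exists_pt hn x
    obtain ⟨c, hc, rfl, hk⟩ := hfull i hi
    obtain ⟨s, hs, rfl⟩ := hlift _ hi c rfl hk t ht
    exact ⟨pt c s, hval c hc s hs⟩
  refine (isPtEpi_iff _).2 ⟨hsurj, fun x y => ⟨fun h => ?_, ?_⟩, fun x y => ⟨fun h => ?_, ?_⟩⟩
  · obtain ⟨i, hi, t, ht, rfl⟩ := exists_pt hn y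
    obtain ⟨c, hc, rfl, hk⟩ := hfull i hi
    obtain ⟨hx, h2 | h2⟩ := R_pt_pred hi ht h
    · obtain ⟨s, hs, hst⟩ := hlift _ hi c rfl hk t ht
      refine ⟨pt c s, pt c s, ?_, ?_, Or.inl rfl⟩
      · rw [hval c hc s hs, hst, h2, ← hx]
      · rw [hval c hc s hs, hst]
    · obtain ⟨s, hs, h3, h4⟩ := (hslow c).exists_step_of_lt (N := N) (a := x.lev) (by omega)
      refine ⟨pt c s, pt c (s + 1), ?_, ?_, R_pt_succ hc hs⟩
      · rw [hval c hc s hs.le, h3, ← hx]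
      · rw [hval c hc (s + 1) hs, h4, h2]
  · rintro ⟨x, y, rfl, rfl, h⟩
    obtain ⟨c, hc, t, ht, rfl⟩ := exists_pt hM y
    obtain ⟨hx, h2⟩ := R_pt_pred hc ht h
    have hs := x.lev_le
    obtain ⟨s, hs'⟩ : ∃ s, s = x.lev := ⟨_, rfl⟩
    rw [← hs'] at hx hs h2
    clear hs'
    subst hx
    simp only [hval c hc s hs, hval c hc t ht]
    rcases h2 with rfl | rfl
    · exact Or.inl rfl
    · rcases (hslow c).succ s with h | h
      · rw [h]; exact Or.inl rfl
      · rw [h]; exact R_pt_succ (hb c) (by have := hle c (s + 1); omega)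
  · rcases Nat.eq_zero_or_pos x.lev with hx | hx
    · obtain ⟨z, hz⟩ := hsurj y
      refine ⟨pt 0 0, z, ?_, hz, Or.inl lev_root⟩
      rw [lev_root, (hslow _).zero, pt_zero, ← eq_root hx]
    rcases Nat.eq_zero_or_pos y.lev with hy | hy
    · obtain ⟨z, hz⟩ := hsurj x
      refine ⟨z, pt 0 0, hz, ?_, Or.inr (Or.inl lev_root)⟩
      rw [lev_root, (hslow _).zero, pt_zero, ← eq_root hy]
    have hxy : x.br ≤ y.br := by
      rcases h with h | h | h <;> omega
    obtain ⟨c, hc, h1, h2⟩ := hfull x.br (br_lt hn x)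
    obtain ⟨d, hd, h3, h4, hcd⟩ : ∃ d < M, b d = y.br ∧ σ d N = k ∧ c ≤ d := by
      obtain ⟨d, hd, h3, h4⟩ := hfull y.br (br_lt hn y)
      by_cases hcd : c ≤ d
      · exact ⟨d, hd, h3, h4, hcd⟩
      · have hk := x.lev_le
        have := hmono d c (by omega) ⟨N, by omega⟩ ⟨N, by omega⟩
        exact ⟨c, hc, by omega, h2, le_rfl⟩
    obtain ⟨s, hs, hs'⟩ := hlift _ (br_lt hn x) c h1 h2 _ x.lev_le
    obtain ⟨t, ht, ht'⟩ := hlift _ (br_lt hn y) d h3 h4 _ y.lev_le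
    refine ⟨pt c s, pt d t, ?_, ?_, S_pt_pt hcd hc hd hs ht⟩
    · rw [hval c hc s hs, h1, hs', pt_br_lev]
    · rw [hval d hd t ht, h3, ht', pt_br_lev]
  · rintro ⟨x, y, rfl, rfl, h⟩
    rcases Nat.eq_zero_or_pos (σ x.br x.lev) with hx | hx
    · rw [hx, pt_zero]; exact Or.inl lev_root
    rcases Nat.eq_zero_or_pos (σ y.br y.lev) with hy | hy
    · rw [hy, pt_zero]; exact Or.inr (Or.inl lev_root)
    have hxy : x.br ≤ y.br := by
      have h1 := (hslow x.br).le_self x.lev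
      have h2 := (hslow y.br).le_self y.lev
      rcases h with h | h | h <;> omega
    exact S_pt_pt (hmono _ _ hxy ⟨_, hx.ne'⟩ ⟨_, hy.ne'⟩) (hb _) (hb _) (hle _ _) (hle _ _)

/-- Larger standard fans project onto smaller ones. -/
theorem exists_isPtEpi_of_le {N M k n : ℕ} (hn : 0 < n) (hk : k ≤ N) (hnM : n ≤ M) :
    ∃ g : Pt N M → Pt k n, IsPtEpi g :=
  ⟨_, isPtEpi_of_slow (b := fun c => min c (n - 1)) (σ := fun _ t => min t k) hn
    (fun _ => IsSlow.min k) (fun _ _ => min_le_right _ _) (fun c => by omega)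
    (fun c c' h _ _ => by omega) (fun i hi => ⟨i, by omega, by omega, by omega⟩)⟩

namespace IsPtEpi

variable {l m k n : ℕ} {g : Pt l m → Pt k n}

theorem map_R (hg : IsPtEpi g) {x y : Pt l m} (h : R x y) : R (g x) (g y) :=
  (((isPtEpi_iff g).1 hg).2.1 _ _).2 ⟨x, y, rfl, rfl, h⟩

theorem map_S (hg : IsPtEpi g) {x y : Pt l m} (h : S x y) : S (g x) (g y) :=
  (((isPtEpi_iff g).1 hg).2.2 _ _).2 ⟨x, y, rfl, rfl, h⟩

theorem pos (hg : IsPtEpi g) (hk : 0 < k) (hn : 0 < n) : 0 < l ∧ 0 < m := by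
  by_contra hlm
  have hroot : ∀ x : Pt l m, x = pt 0 0 := by
    intro x
    refine eq_root ?_
    rcases x.prop with h | h <;> omega
  obtain ⟨x, hx⟩ := hg.surjective (pt 0 1 : Pt k n)
  obtain ⟨y, hy⟩ := hg.surjective (pt 0 0 : Pt k n)
  have : (pt 0 1 : Pt k n) = pt 0 0 := by rw [← hx, ← hy, hroot x, hroot y]
  have h1 := congrArg lev this
  rw [lev_pt hn hk, lev_root] at h1
  omega

/-- An epimorphism maps each branch by a slow map into a branch. -/
theorem apply_pt (hg : IsPtEpi g) (hn : 0 < n) {j : ℕ} (hj : j < m) {t : ℕ} (ht : t ≤ l) :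
    g (pt j t) = pt (g (pt j l)).br (g (pt j t)).lev := by
  refine Nat.decreasingInduction (motive := fun t _ => g (pt j t) = pt (g (pt j l)).br
    (g (pt j t)).lev) (fun t ht ih => ?_) (by rw [pt_br_lev]) ht
  have h := hg.map_R (R_pt_succ hj ht)
  rw [ih] at h
  exact (R_pt_pred (br_lt hn _) (lev_le _) h).1

theorem lev_succ (hg : IsPtEpi g) {j : ℕ} (hj : j < m) {t : ℕ} (ht : t < l) :
    (g (pt j (t + 1))).lev = (g (pt j t)).lev ∨ (g (pt j (t + 1))).lev = (g (pt j t)).lev + 1 :=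
  (R_pred (hg.map_R (R_pt_succ hj ht))).2

theorem lev_mono (hg : IsPtEpi g) {j : ℕ} (hj : j < m) {s t : ℕ} (hst : s ≤ t) (ht : t ≤ l) :
    (g (pt j s)).lev ≤ (g (pt j t)).lev := by
  induction t, hst using Nat.le_induction with
  | base => exact le_rfl
  | succ t _ ih =>
    have := ih (by omega)
    rcases hg.lev_succ hj (t := t) (by omega) with h | h <;> omega

theorem map_root (hg : IsPtEpi g) (hm : 0 < m) : g (pt 0 0) = pt 0 0 := by
  obtain ⟨x, hx⟩ := hg.surjective (pt 0 0 : Pt k n)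
  obtain ⟨j, hj, t, ht, rfl⟩ := exists_pt hm x
  have hx : (g (pt j t)).lev = 0 := by rw [show g (pt j t) = pt 0 0 from hx, lev_root]
  refine eq_root ?_
  have := hg.lev_mono hj (Nat.zero_le t) ht
  rw [pt_zero] at this
  omega

/-- An epimorphism between standard fans is given by a nondecreasing placement of the branches and
slow maps on them, where each branch is covered. -/
theorem exists_slow (hg : IsPtEpi g) (hk : 0 < k) (hn : 0 < n) : ∃ (b : ℕ → ℕ) (p : ℕ → ℕ → ℕ),
    (∀ j, b j < n) ∧ (∀ j < m, IsSlow (p j)) ∧ (∀ j t, p j t ≤ k) ∧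
    (∀ j < m, ∀ t ≤ l, g (pt j t) = pt (b j) (p j t)) ∧
    (∀ j j', j ≤ j' → j' < m → 0 < p j l → 0 < p j' l → b j ≤ b j') ∧
    (∀ i < n, ∃ j < m, b j = i ∧ p j l = k) := by
  have hm := (hg.pos hk hn).2
  have hmin : ∀ t ≤ l, min t l = t := fun t ht => min_eq_left ht
  refine ⟨fun j => (g (pt j l)).br, fun j t => (g (pt j (min t l))).lev, fun j => br_lt hn _,
    fun j hj => ⟨?_, fun t => ?_⟩, fun j t => lev_le _, fun j hj t ht => ?_,
    fun j j' hjj' hj' h h' => ?_, fun i hi => ?_⟩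
  · simp only [Nat.zero_min, pt_zero, hg.map_root hm, lev_root]
  · rcases lt_or_ge t l with h | h
    · simp only [hmin t h.le, hmin (t + 1) h]
      exact hg.lev_succ hj h
    · simp only [min_eq_right h, min_eq_right (h.trans (Nat.le_succ t)), true_or]
  · simp only [hmin t ht]
    exact hg.apply_pt hn hj ht
  · simp only [min_self] at h h'
    have := hg.map_S (S_pt_pt hjj' (hjj'.trans_lt hj') hj' (le_refl l) (le_refl l))
    rcases this with h1 | h1 | h1
    · omega
    · omega
    · exact h1
  · obtain ⟨x, hx⟩ := hg.surjective (pt i k : Pt k n)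
    obtain ⟨j, hj, t, ht, rfl⟩ := exists_pt hm x
    have hx : g (pt j t) = pt i k := hx
    have hk' : (g (pt j t)).lev = k := by rw [hx, lev_pt hi le_rfl]
    have h1 := hg.lev_mono hj ht le_rfl
    have h2 := lev_le (g (pt j l))
    refine ⟨j, hj, ?_, by simp only [min_self]; omega⟩
    have := hg.apply_pt hn hj ht
    rw [hk', hx] at this
    have := congrArg br this
    rw [br_pt hi le_rfl hk, br_pt (br_lt hn _) le_rfl hk] at this
    exact this.symm

end IsPtEpi

/-! ### The Ramsey property of ordered fans -/

/-- The product `Q i k * Q (i + 1) k * ⋯ * Q (n - 1) k`. -/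
def fullProd {M : Type*} [Monoid M] (Q : ℕ → ℕ → M) (k n i : ℕ) : M :=
  ((List.range' i (n - i)).map fun i => Q i k).prod

theorem fullProd_eq_mul {M : Type*} [Monoid M] (Q : ℕ → ℕ → M) (k : ℕ) {n i : ℕ} (hi : i < n) :
    fullProd Q k n i = Q i k * fullProd Q k n (i + 1) := by
  rw [fullProd, fullProd, show n - i = (n - (i + 1)) + 1 by omega, List.range'_succ, List.map_cons,
    List.prod_cons]

theorem fullProd_self {M : Type*} [Monoid M] (Q : ℕ → ℕ → M) (k n : ℕ) :
    fullProd Q k n n = 1 := by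
  simp [fullProd]

section Product

variable {M : Type*} [Monoid M] {Q : ℕ → ℕ → M} {k n : ℕ}

/-- Reading a product of factors `Q i a` from left to right, with `Q i a` the accumulated factor of
the current label `i`. -/
theorem mul_prod_eq_fullProd (hk : 0 < k)
    (hQ : ∀ i, ∀ a ≤ k, ∀ b ≤ k, Q i a * Q i b = Q i (max a b)) (h0 : ∀ i i', Q i 0 = Q i' 0)
    (L : List (ℕ × ℕ)) : ∀ i < n, ∀ a ≤ k,
      (∀ x ∈ L, x.2 ≤ k ∧ (0 < x.2 → i ≤ x.1 ∧ x.1 < n)) →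
      L.Pairwise (fun x y => 0 < x.2 → 0 < y.2 → x.1 ≤ y.1) →
      (a = k ∨ (i, k) ∈ L) → (∀ i', i < i' → i' < n → (i', k) ∈ L) →
      Q i a * (L.map fun x => Q x.1 x.2).prod = fullProd Q k n i := by
  induction L with
  | nil =>
    intro i hi a _ _ _ hfull hrest
    obtain rfl : a = k := by simpa using hfull
    have hin : n = i + 1 := by
      by_contra h
      simpa using hrest (i + 1) (by omega) (by omega)
    subst hin
    rw [fullProd_eq_mul Q a hi, fullProd_self, List.map_nil, List.prod_nil]
  | cons x L ih =>
    obtain ⟨j, b⟩ := x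
    intro i hi a ha hL hpair hfull hrest
    rw [List.pairwise_cons] at hpair
    have hb := (hL (j, b) (by simp)).1
    have hL' : ∀ x ∈ L, x.2 ≤ k ∧ (0 < x.2 → i ≤ x.1 ∧ x.1 < n) := fun x hx =>
      hL x (List.mem_cons_of_mem _ hx)
    simp only [List.map_cons, List.prod_cons]
    simp only at hb
    rcases Nat.eq_zero_or_pos b with rfl | hb0
    · rw [h0 j i, ← mul_assoc, hQ i a ha 0 (Nat.zero_le _), Nat.max_zero]
      refine ih i hi a ha hL' hpair.2 ?_ fun i' h1 h2 => ?_
      · refine hfull.imp_right fun h => (List.mem_cons.1 h).resolve_left fun h => ?_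
        have := congrArg Prod.snd h
        simp only at this
        omega
      · refine (List.mem_cons.1 (hrest i' h1 h2)).resolve_left fun h => ?_
        have := congrArg Prod.snd h
        simp only at this
        omega
    obtain ⟨hij, hjn⟩ := (hL (j, b) (by simp)).2 hb0
    simp only at hij hjn
    rcases hij.eq_or_lt with rfl | hij
    · rw [← mul_assoc, hQ i a ha b hb]
      refine ih i hi (max a b) (by omega) hL' hpair.2 ?_ fun i' h1 h2 => ?_
      · rcases hfull with h | h
        · left; omega
        · rcases List.mem_cons.1 h with h | h
          · have := congrArg Prod.snd h
            simp only at this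
            left; omega
          · exact Or.inr h
      · refine (List.mem_cons.1 (hrest i' h1 h2)).resolve_left fun h => ?_
        have := congrArg Prod.fst h
        simp only at this
        omega
    · have hmem : ∀ i', i' < j → (i', k) ∉ (j, b) :: L := by
        intro i' hi' h
        rcases List.mem_cons.1 h with h | h
        · have := congrArg Prod.fst h
          simp only at this
          omega
        · have := hpair.1 _ h hb0 hk
          simp only at this
          omega
      obtain rfl : a = k := hfull.resolve_right (hmem i hij)
      obtain rfl : j = i + 1 := by
        by_contra h
        exact hmem (i + 1) (by omega) (hrest (i + 1) (by omega) (by omega))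
      rw [fullProd_eq_mul Q a hi, ih (i + 1) hjn b hb (fun x hx => ⟨(hL' x hx).1, fun hx0 =>
        ⟨hpair.1 x hx hb0 hx0, ((hL' x hx).2 hx0).2⟩⟩) hpair.2 ?_ fun i' h1 h2 => ?_]
      · rcases List.mem_cons.1 (hrest (i + 1) (by omega) (by omega)) with h | h
        · have := congrArg Prod.snd h
          simp only at this
          exact Or.inl this.symm
        · exact Or.inr h
      · refine (List.mem_cons.1 (hrest i' (by omega) h2)).resolve_left fun h => ?_
        have := congrArg Prod.fst h
        simp only at this
        omega

/-- The product of the ultrafilters attached to an epimorphism depends only on its target. -/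
theorem prod_eq_fullProd (hk : 0 < k) (hn : 0 < n)
    (hQ : ∀ i, ∀ a ≤ k, ∀ b ≤ k, Q i a * Q i b = Q i (max a b)) (h0 : ∀ i i', Q i 0 = Q i' 0)
    {L : List (ℕ × ℕ)} (hL : ∀ x ∈ L, x.2 ≤ k ∧ x.1 < n)
    (hpair : L.Pairwise (fun x y => 0 < x.2 → 0 < y.2 → x.1 ≤ y.1))
    (hfull : ∀ i < n, (i, k) ∈ L) :
    (L.map fun x => Q x.1 x.2).prod = fullProd Q k n 0 := by
  rw [← mul_prod_eq_fullProd hk hQ h0 L 0 hn 0 (Nat.zero_le _)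
    (fun x hx => ⟨(hL x hx).1, fun _ => ⟨Nat.zero_le _, (hL x hx).2⟩⟩) hpair (Or.inr (hfull 0 hn))
    fun i' _ h => hfull i' h]
  cases L with
  | nil => simpa using hfull 0 hn
  | cons x L =>
    rw [List.map_cons, List.prod_cons, ← mul_assoc, h0 0 x.1, hQ x.1 0 (Nat.zero_le _) x.2
      (hL x (by simp)).1, Nat.zero_max]

end Product

/-- Words with labelled letters. Such a word describes a map into a standard fan, the label of a
letter being the number of the branch to which it belongs. -/
abbrev LabelledWord := FreeMonoid (ℕ × (ℕ → ℕ))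

/-- Attach the label `j` to each letter. -/
def label (j : ℕ) : Word →* LabelledWord := FreeMonoid.map fun σ => (j, σ)

/-- Turn a labelled word into a word with letters in the target of `g`. -/
def evalWord {l m : ℕ} {α : Type*} (g : Pt l m → α) : LabelledWord →* FreeMonoid (ℕ → α) :=
  FreeMonoid.map fun x t => g (pt x.1 (x.2 t))

/-- The map described by a word `w`: the branch number `c` is mapped by the `c`-th letter, and the
branches beyond the length of the word go to the root. -/
def wordMap {k n : ℕ} (N : ℕ) (w : FreeMonoid (ℕ → Pt k n)) (x : Pt N N) : Pt k n :=
  (w.toList.getD x.br fun _ => pt 0 0) x.lev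

theorem wordMap_evalWord {l m k n N : ℕ} {g : Pt l m → Pt k n} (hg : g (pt 0 0) = pt 0 0)
    (L : LabelledWord) : wordMap N (evalWord g L) = g ∘ wordMap N (evalWord id L) := by
  funext x
  simp only [wordMap, evalWord, FreeMonoid.toList_map, Function.comp, id]
  rcases lt_or_ge x.br (FreeMonoid.toList L).length with h | h
  · simp [h]
  · simp [h, hg]

/-- The labelled words that describe epimorphisms onto the standard fan with `m` branches of
height `l`. -/
structure IsGoodWord (l m : ℕ) (L : LabelledWord) : Prop where
  label_lt : ∀ x ∈ L, x.1 < m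
  slow : ∀ x ∈ L, IsSlow x.2
  le : ∀ x ∈ L, ∀ t, x.2 t ≤ l
  sorted : L.toList.Pairwise fun x y => x.1 ≤ y.1
  full : ∀ j < m, ∃ x ∈ L, x.1 = j ∧ ∃ t, x.2 t = l

theorem IsGoodWord.mul_label {l m : ℕ} {L : LabelledWord} (hL : IsGoodWord l m L) {w : Word}
    (hw : w ∈ levelWords l) : IsGoodWord l (m + 1) (L * label m w) := by
  have hlab : ∀ x ∈ label m w, x.1 = m ∧ x.2 ∈ w := by
    intro x hx
    obtain ⟨σ, hσ, rfl⟩ := FreeMonoid.mem_map.1 hx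
    exact ⟨rfl, hσ⟩
  refine ⟨fun x hx => ?_, fun x hx => ?_, fun x hx => ?_, ?_, fun j hj => ?_⟩
  · rcases FreeMonoid.mem_mul.1 hx with h | h
    · exact (hL.label_lt x h).trans (Nat.lt_succ_self m)
    · rw [(hlab x h).1]; exact Nat.lt_succ_self m
  · rcases FreeMonoid.mem_mul.1 hx with h | h
    · exact hL.slow x h
    · exact (hw.1 _ (hlab x h).2).1
  · rcases FreeMonoid.mem_mul.1 hx with h | h
    · exact hL.le x h
    · exact (hw.1 _ (hlab x h).2).2
  · rw [FreeMonoid.toList_mul, List.pairwise_append]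
    refine ⟨hL.sorted, ?_, fun x hx y hy => ?_⟩
    · rw [label, FreeMonoid.toList_map, List.pairwise_map]
      exact List.pairwise_of_forall fun _ _ => le_rfl
    · rw [(hlab y hy).1]; exact (hL.label_lt x hx).le
  · rcases (Nat.lt_succ_iff_lt_or_eq.1 hj) with h | rfl
    · obtain ⟨x, hx, h⟩ := hL.full j h
      exact ⟨x, FreeMonoid.mem_mul.2 (Or.inl hx), h⟩
    · obtain ⟨σ, hσ, h⟩ := hw.2
      exact ⟨(j, σ), FreeMonoid.mem_mul.2 (Or.inr (FreeMonoid.mem_map.2 ⟨σ, hσ, rfl⟩)), rfl, h⟩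

theorem IsGoodWord.eventually_isPtEpi {l m : ℕ} (hm : 0 < m) {L : LabelledWord}
    (hL : IsGoodWord l m L) :
    ∀ᶠ N in atTop, IsPtEpi (wordMap N (evalWord (id : Pt l m → Pt l m) L)) := by
  have hfull : ∀ j ∈ Finset.range m, ∀ᶠ N in atTop, ∃ x ∈ L, x.1 = j ∧ x.2 N = l := by
    intro j hj
    obtain ⟨x, hx, hxj, t, ht⟩ := hL.full j (Finset.mem_range.1 hj)
    filter_upwards [eventually_ge_atTop t] with N hN
    exact ⟨x, hx, hxj, le_antisymm (hL.le x hx N) (ht ▸ (hL.slow x hx).monotone hN)⟩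
  filter_upwards [(Finset.eventually_all _).2 hfull,
    eventually_ge_atTop L.toList.length] with N hN hlen
  -- The letters beyond the length of the word are sent to the root.
  set z : ℕ × (ℕ → ℕ) := (0, fun _ => 0) with hz
  have hget : ∀ c, L.toList.getD c z ∈ L ∨ L.toList.getD c z = z := by
    intro c
    rcases lt_or_ge c L.toList.length with h | h
    · left
      rw [List.getD_eq_getElem _ _ h]
      exact List.getElem_mem h
    · right
      rw [List.getD_eq_default _ _ h]
  have heq : wordMap N (evalWord (id : Pt l m → Pt l m) L) = fun x : Pt N N =>
      (pt (L.toList.getD x.br z).1 ((L.toList.getD x.br z).2 x.lev) : Pt l m) := by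
    funext x
    simp only [wordMap, evalWord, FreeMonoid.toList_map, id]
    rcases lt_or_ge x.br L.toList.length with h | h
    · simp [h]
    · simp [h, hz]
  rw [heq]
  refine isPtEpi_of_slow (b := fun c => (L.toList.getD c z).1)
    (σ := fun c => (L.toList.getD c z).2) hm (fun c => ?_) (fun c => ?_) (fun c => ?_)
    (fun c c' hcc' _ hc' => ?_) fun i hi => ?_
  · rcases hget c with h | h
    · exact hL.slow _ h
    · rw [h]; exact ⟨rfl, fun _ => Or.inl rfl⟩
  · rcases hget c with h | h
    · exact hL.le _ h
    · rw [h]; exact fun _ => Nat.zero_le _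
  · rcases hget c with h | h
    · exact hL.label_lt _ h
    · rw [h]; exact hm
  · have h' : c' < L.toList.length := by
      by_contra h
      obtain ⟨t, ht⟩ := hc'
      rw [List.getD_eq_default _ _ (by omega)] at ht
      exact ht rfl
    rcases hcc'.eq_or_lt with rfl | h
    · exact le_rfl
    · rw [List.getD_eq_getElem _ _ h', List.getD_eq_getElem _ _ (h.trans h')]
      exact List.pairwise_iff_getElem.1 hL.sorted c c' _ h' h
  · obtain ⟨x, hx, hxi, hxN⟩ := hN i (Finset.mem_range.2 hi)
    obtain ⟨c, hc, rfl⟩ := List.getElem_of_mem (l := L.toList) hx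
    refine ⟨c, hc.trans_le hlen, ?_, ?_⟩
    · rw [List.getD_eq_getElem _ _ hc]; exact hxi
    · rw [List.getD_eq_getElem _ _ hc]; exact hxN

/-- The ultrafilter on labelled words from which the epimorphisms onto the standard fan with `m`
branches of height `l` are taken. -/
noncomputable def fanUltrafilter (q : ℕ → Ultrafilter Word) (l m : ℕ) : Ultrafilter LabelledWord :=
  ((List.range m).map fun j => (q l).map (label j)).prod

theorem eventually_isGoodWord {q : ℕ → Ultrafilter Word} (hq : IsCoherent q) (l m : ℕ) :
    ∀ᶠ L in (fanUltrafilter q l m : Filter LabelledWord), IsGoodWord l m L := by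
  induction m with
  | zero =>
    simp only [fanUltrafilter, List.range_zero, List.map_nil, List.prod_nil, eventually_one_iff]
    refine ⟨fun x hx => ?_, fun x hx => ?_, fun x hx => ?_, List.Pairwise.nil,
      fun j hj => absurd hj (Nat.not_lt_zero j)⟩ <;> exact absurd hx List.not_mem_nil
  | succ m ih =>
    rw [show fanUltrafilter q l (m + 1) = fanUltrafilter q l m * (q l).map (label m) by
      simp [fanUltrafilter, List.range_succ], eventually_mul_iff]
    filter_upwards [ih] with L hL
    rw [eventually_map_iff]
    filter_upwards [hq.level l] with w hw using hL.mul_label hw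

theorem map_congr_of_mem {α β : Type*} {f g : α → β} {w : FreeMonoid α} (h : ∀ a ∈ w, f a = g a) :
    FreeMonoid.map f w = FreeMonoid.map g w :=
  List.map_congr_left h

/-- All epimorphisms between two given standard fans send `fanUltrafilter` to the same
ultrafilter. -/
theorem exists_map_fanUltrafilter {k n : ℕ} (hk : 0 < k) (hn : 0 < n) {q : ℕ → Ultrafilter Word}
    (hq : IsCoherent q) (hqk : ∀ i ≤ k, ∀ j ≤ k, q i * q j = q (max i j)) :
    ∃ U : Ultrafilter (FreeMonoid (ℕ → Pt k n)), ∀ l m, ∀ g : Pt l m → Pt k n, IsPtEpi g →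
      (fanUltrafilter q l m).map (evalWord g) = U := by
  set lab : ℕ → Word →* FreeMonoid (ℕ → Pt k n) := fun i =>
    FreeMonoid.map fun σ t => (pt i (σ t) : Pt k n) with hlab
  set Q : ℕ → ℕ → Ultrafilter (FreeMonoid (ℕ → Pt k n)) := fun i a => (q a).map (lab i) with hQdef
  have hQ : ∀ i, ∀ a ≤ k, ∀ b ≤ k, Q i a * Q i b = Q i (max a b) := by
    intro i a ha b hb
    simp only [hQdef, ← map_mul_ultrafilter, hqk a ha b hb]
  have h0 : ∀ i i', Q i 0 = Q i' 0 := by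
    intro i i'
    refine map_congr_ultrafilter ?_
    filter_upwards [hq.level 0] with w hw
    refine map_congr_of_mem fun σ hσ => funext fun t => ?_
    rw [Nat.le_zero.1 ((hw.1 σ hσ).2 t), pt_zero, pt_zero i']
  refine ⟨fullProd Q k n 0, fun l m g hg => ?_⟩
  obtain ⟨b, p, hb, hp, hpk, hgp, hmono, hfull⟩ := hg.exists_slow hk hn
  have hj : ∀ j ∈ List.range m, ((q l).map (label j)).map (evalWord g) = Q (b j) (p j l) := by
    intro j hj
    rw [List.mem_range] at hj
    simp only [hQdef]
    rw [← hq.map_subst (p j) (hp j hj) l, Ultrafilter.map_map, Ultrafilter.map_map]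
    refine map_congr_ultrafilter ?_
    filter_upwards [hq.level l] with w hw
    simp only [Function.comp, evalWord, label, hlab, subst, FreeMonoid.map_map]
    refine map_congr_of_mem fun σ hσ => funext fun t => ?_
    exact hgp j hj _ ((hw.1 σ hσ).2 t)
  rw [fanUltrafilter, map_list_prod_ultrafilter, List.map_map]
  rw [← prod_eq_fullProd hk hn hQ h0 (L := (List.range m).map fun j => (b j, p j l)) ?_ ?_ ?_,
    List.map_map]
  · congr 1
    exact List.map_congr_left hj
  · intro x hx
    obtain ⟨j, _, rfl⟩ := List.mem_map.1 hx
    exact ⟨hpk j l, hb j⟩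
  · rw [List.pairwise_map]
    refine (List.pairwise_lt_range (n := m)).imp_of_mem fun {i j} hi hj' hij h1 h2 => ?_
    exact hmono i j hij.le (List.mem_range.1 hj') h1 h2
  · intro i hi
    obtain ⟨j, hj', rfl, h⟩ := hfull i hi
    exact List.mem_map.2 ⟨j, List.mem_range.2 hj', by rw [h]⟩

/-- A function to a finite set is constant along an ultrafilter. -/
theorem exists_eventually_eq {M κ : Type*} [Finite κ] (U : Ultrafilter M) (χ : M → κ) :
    ∃ c, ∀ᶠ x in (U : Filter M), χ x = c := by
  by_contra h
  push Not at h
  have : ∀ᶠ x in (U : Filter M), ∀ c, χ x ≠ c :=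
    eventually_all.2 h
  obtain ⟨x, hx⟩ := this.exists
  exact hx _ rfl

/-- The Ramsey property. If all `N` had a bad coloring, then the limit of these colorings along an
ultrafilter would color the words of all lengths, and the ultrafilters on words would provide
a contradiction. -/
theorem exists_ramsey {k n l m : ℕ} (hk : 0 < k) (hn : 0 < n) (hm : 0 < m)
    (κ : Type*) [Finite κ] : ∃ N, 0 < N ∧ ∀ χ : (Pt N N → Pt k n) → κ,
      ∃ f : Pt N N → Pt l m, IsPtEpi f ∧ ∃ c, ∀ g : Pt l m → Pt k n, IsPtEpi g → χ (g ∘ f) = c := by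
  by_contra hcon
  push Not at hcon
  have : Nonempty κ := by
    obtain ⟨χ, _⟩ := hcon 1 one_pos
    exact ⟨χ fun _ => pt 0 0⟩
  choose! χ hχ using hcon
  obtain ⟨q, hq, hqk⟩ := exists_isCoherent_max k
  obtain ⟨U, hU⟩ := exists_map_fanUltrafilter hk hn hq hqk
  -- The limit coloring of the words along a nonprincipal ultrafilter, and its value along `U`.
  have hlim : ∀ w : FreeMonoid (ℕ → Pt k n), ∃ c, ∀ᶠ N in (hyperfilter ℕ : Filter ℕ),
      χ N (wordMap N w) = c := fun w => exists_eventually_eq _ fun N => χ N (wordMap N w)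
  choose χ' hχ' using hlim
  obtain ⟨c, hc⟩ := exists_eventually_eq U χ'
  have hgood : ∀ᶠ L in (fanUltrafilter q l m : Filter LabelledWord), ∀ g : Pt l m → Pt k n,
      IsPtEpi g → χ' (evalWord g L) = c := by
    refine eventually_all.2 fun g => ?_
    by_cases hg : IsPtEpi g
    · rw [← hU l m g hg, eventually_map_iff] at hc
      filter_upwards [hc] with L hL _ using hL
    · exact Eventually.of_forall fun L h => absurd h hg
  obtain ⟨L, hL, hLgood⟩ := (hgood.and (eventually_isGoodWord hq l m)).exists
  have hN : ∀ᶠ N in (hyperfilter ℕ : Filter ℕ), ∀ g : Pt l m → Pt k n, IsPtEpi g →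
      χ N (wordMap N (evalWord g L)) = c := by
    refine eventually_all.2 fun g => ?_
    by_cases hg : IsPtEpi g
    · filter_upwards [hχ' (evalWord g L)] with N hN _
      rw [hN, hL g hg]
    · exact Eventually.of_forall fun L h => absurd h hg
  -- A fan large enough that the limit colors of the relevant words, finitely many, are attained.
  obtain ⟨N, hN, hN0, hepi⟩ := (hN.and ((eventually_hyperfilter_ge 1).and
    (Nat.hyperfilter_le_atTop (hLgood.eventually_isPtEpi hm)))).exists
  obtain ⟨g, hg, hne⟩ := hχ N hN0 _ hepi c
  refine hne ?_
  rw [← wordMap_evalWord (hg.map_root hm)]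
  exact hN g hg

end Fan

namespace TopStructure

/-! ### Composition of epimorphisms -/

theorem IsEpi.comp {A B C : TopStructure} {g : B → A} {f : C → B} (hg : IsEpi g) (hf : IsEpi f) :
    IsEpi (g ∘ f : C → A) where
  continuous := hg.continuous.comp hf.continuous
  surjective := hg.surjective.comp hf.surjective
  R_iff x₁ x₂ := by
    rw [hg.R_iff]
    constructor
    · rintro ⟨y₁, y₂, h1, h2, h⟩
      obtain ⟨z₁, z₂, rfl, rfl, h'⟩ := (hf.R_iff y₁ y₂).1 h
      exact ⟨z₁, z₂, h1, h2, h'⟩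
    · rintro ⟨z₁, z₂, h1, h2, h⟩
      exact ⟨f z₁, f z₂, h1, h2, (hf.R_iff _ _).2 ⟨z₁, z₂, rfl, rfl, h⟩⟩
  S_iff x₁ x₂ := by
    rw [hg.S_iff]
    constructor
    · rintro ⟨y₁, y₂, h1, h2, h⟩
      obtain ⟨z₁, z₂, rfl, rfl, h'⟩ := (hf.S_iff y₁ y₂).1 h
      exact ⟨z₁, z₂, h1, h2, h'⟩
    · rintro ⟨z₁, z₂, h1, h2, h⟩
      exact ⟨f z₁, f z₂, h1, h2, (hf.S_iff _ _).2 ⟨z₁, z₂, rfl, rfl, h⟩⟩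

theorem IsEpi.of_comp {A B C : TopStructure} {g : B → A} {f : C → B} (hg : Continuous g)
    (hgf : IsEpi (g ∘ f : C → A)) (hf : IsEpi f) : IsEpi g where
  continuous := hg
  surjective := hgf.surjective.of_comp
  R_iff x₁ x₂ := by
    rw [hgf.R_iff]
    constructor
    · rintro ⟨z₁, z₂, h1, h2, h⟩
      exact ⟨f z₁, f z₂, h1, h2, (hf.R_iff _ _).2 ⟨z₁, z₂, rfl, rfl, h⟩⟩
    · rintro ⟨y₁, y₂, h1, h2, h⟩
      obtain ⟨z₁, z₂, rfl, rfl, h'⟩ := (hf.R_iff y₁ y₂).1 h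
      exact ⟨z₁, z₂, h1, h2, h'⟩
  S_iff x₁ x₂ := by
    rw [hgf.S_iff]
    constructor
    · rintro ⟨z₁, z₂, h1, h2, h⟩
      exact ⟨f z₁, f z₂, h1, h2, (hf.S_iff _ _).2 ⟨z₁, z₂, rfl, rfl, h⟩⟩
    · rintro ⟨y₁, y₂, h1, h2, h⟩
      obtain ⟨z₁, z₂, rfl, rfl, h'⟩ := (hf.S_iff y₁ y₂).1 h
      exact ⟨z₁, z₂, h1, h2, h'⟩

theorem IsEpi.map_R {A B : TopStructure} {g : B → A} (hg : IsEpi g) {x y : B} (h : B.R x y) :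
    A.R (g x) (g y) :=
  (hg.R_iff _ _).2 ⟨x, y, rfl, rfl, h⟩

theorem IsEpi.map_S {A B : TopStructure} {g : B → A} (hg : IsEpi g) {x y : B} (h : B.S x y) :
    A.S (g x) (g y) :=
  (hg.S_iff _ _).2 ⟨x, y, rfl, rfl, h⟩

/-- A bijective continuous map that preserves and reflects the relations is an isomorphism. -/
theorem isIso_of_bijective {L : TopStructure.{u}} {f : L → L} (hc : Continuous f)
    (hb : Function.Bijective f) (hR : ∀ x y, L.R (f x) (f y) ↔ L.R x y)
    (hS : ∀ x y, L.S (f x) (f y) ↔ L.S x y) : IsIso f :=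
  ⟨isEpi_of_map_iff
    (h := Continuous.homeoOfEquivCompactToT2 (f := Equiv.ofBijective f hb) hc) hR hS, hb⟩

/-! ### Inverse limits -/

/-- Related points at one level of an inverse sequence lift to related threads. -/
theorem exists_threads {D : ℕ → Type*} {e : ∀ i, D (i + 1) → D i} {Q : ∀ i, D i → D i → Prop}
    (hdown : ∀ i y z, Q (i + 1) y z → Q i (e i y) (e i z))
    (hup : ∀ i y z, Q i y z → ∃ y' z', e i y' = y ∧ e i z' = z ∧ Q (i + 1) y' z') (i : ℕ)
    {y z : D i} (h : Q i y z) : ∃ x x' : ∀ j, D j, (∀ j, e j (x (j + 1)) = x j) ∧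
      (∀ j, e j (x' (j + 1)) = x' j) ∧ x i = y ∧ x' i = z ∧ ∀ j, Q j (x j) (x' j) := by
  induction i generalizing D with
  | zero =>
    choose up₁ up₂ h1 h2 h3 using hup
    let t : ∀ j, {p : D j × D j // Q j p.1 p.2} := fun j =>
      Nat.rec ⟨(y, z), h⟩ (fun j p => ⟨(up₁ j _ _ p.2, up₂ j _ _ p.2), h3 j _ _ p.2⟩) j
    exact ⟨fun j => (t j).1.1, fun j => (t j).1.2, fun j => h1 j _ _ (t j).2,
      fun j => h2 j _ _ (t j).2, rfl, rfl, fun j => (t j).2⟩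
  | succ i ih =>
    obtain ⟨x, x', hx, hx', h1, h2, h3⟩ := ih (D := fun j => D (j + 1)) (e := fun j => e (j + 1))
      (Q := fun j => Q (j + 1)) (fun j => hdown (j + 1)) (fun j => hup (j + 1)) h
    refine ⟨fun j => Nat.casesOn j (e 0 (x 0)) x, fun j => Nat.casesOn j (e 0 (x' 0)) x',
      fun j => ?_, fun j => ?_, h1, h2, fun j => ?_⟩
    · cases j with
      | zero => rfl
      | succ j => exact hx j
    · cases j with
      | zero => rfl
      | succ j => exact hx' j
    · cases j with
      | zero => exact hdown 0 _ _ (h3 0)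
      | succ j => exact h3 j

section InvLimit

variable (D : ℕ → TopStructure.{0}) (e : ∀ i, D (i + 1) → D i)

/-- The underlying space of the inverse limit of a sequence of topological structures: the threads.
The index set is lifted so that the limit can live in any universe. -/
def Thread : Type u :=
  ({x | ∀ i : ℕ, e i (x ⟨i + 1⟩) = x ⟨i⟩} : Set ((i : ULift.{u} ℕ) → D i.down))

instance : TopologicalSpace (Thread.{u} D e) := inferInstanceAs (TopologicalSpace (Subtype _))
instance : T2Space (Thread.{u} D e) := inferInstanceAs (T2Space (Subtype _))
instance : TotallyDisconnectedSpace (Thread.{u} D e) :=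
  inferInstanceAs (TotallyDisconnectedSpace (Subtype _))
instance : SecondCountableTopology (Thread.{u} D e) :=
  TopologicalSpace.Subtype.secondCountableTopology
    ({x | ∀ i : ℕ, e i (x ⟨i + 1⟩) = x ⟨i⟩} : Set ((i : ULift.{u} ℕ) → D i.down))

variable {D e}

/-- The projection of a thread to the `i`-th structure. -/
def Thread.proj (i : ℕ) (x : Thread.{u} D e) : D i := x.1 ⟨i⟩

theorem Thread.continuous_proj (i : ℕ) : Continuous (Thread.proj i : Thread.{u} D e → D i) :=
  (continuous_apply (A := fun i : ULift.{u} ℕ => D i.down) ⟨i⟩).comp continuous_subtype_val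

theorem Thread.proj_succ (i : ℕ) (x : Thread.{u} D e) : e i (x.proj (i + 1)) = x.proj i := x.2 i

theorem Thread.ext {x y : Thread.{u} D e} (h : ∀ i, x.proj i = y.proj i) : x = y :=
  Subtype.ext (funext fun i => h i.down)

/-- The inverse limit of a sequence of topological structures with continuous bonding maps. -/
def invLimit (D : ℕ → TopStructure.{0}) (e : ∀ i, D (i + 1) → D i) (he : ∀ i, Continuous (e i)) :
    TopStructure.{u} where
  carrier := Thread.{u} D e
  compact := by
    refine (isCompact_iff_compactSpace (s := ({x | ∀ i : ℕ, e i (x ⟨i + 1⟩) = x ⟨i⟩} :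
      Set ((i : ULift.{u} ℕ) → D i.down)))).1 (IsClosed.isCompact ?_)
    simp only [Set.ofPred_forall]
    exact isClosed_iInter fun i => isClosed_eq ((he i).comp (continuous_apply
      (A := fun i : ULift.{u} ℕ => D i.down) ⟨i + 1⟩)) (continuous_apply _)
  R x y := ∀ i, (D i).R (x.proj i) (y.proj i)
  S x y := ∀ i, (D i).S (x.proj i) (y.proj i)
  isClosed_R := by
    simp only [Set.ofPred_forall]
    exact isClosed_iInter fun i => (D i).isClosed_R.preimage
      ((Thread.continuous_proj i).prodMap (Thread.continuous_proj i))
  isClosed_S := by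
    simp only [Set.ofPred_forall]
    exact isClosed_iInter fun i => (D i).isClosed_S.preimage
      ((Thread.continuous_proj i).prodMap (Thread.continuous_proj i))

theorem isEpi_proj (he : ∀ i, IsEpi (e i)) (i : ℕ) :
    IsEpi (B := invLimit.{u} D e fun i => (he i).continuous) (Thread.proj i) where
  continuous := Thread.continuous_proj i
  surjective y := by
    obtain ⟨x, _, hx, _, h, _⟩ := exists_threads (Q := fun i => @Eq (D i)) (e := e)
      (fun i y z h => h ▸ rfl) (fun i y z h => by
        subst h
        obtain ⟨y', rfl⟩ := (he i).surjective y
        exact ⟨y', y', rfl, rfl, rfl⟩) i (rfl : y = y)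
    exact ⟨⟨fun j => x j.down, hx⟩, h⟩
  R_iff y z := by
    constructor
    · intro h
      obtain ⟨x, x', hx, hx', h1, h2, h3⟩ := exists_threads (Q := fun i => (D i).R) (e := e)
        (fun i y z h => (he i).map_R h) (fun i y z h => ((he i).R_iff y z).1 h) i h
      exact ⟨⟨fun j => x j.down, hx⟩, ⟨fun j => x' j.down, hx'⟩, h1, h2, h3⟩
    · rintro ⟨x, x', rfl, rfl, h⟩
      exact h i
  S_iff y z := by
    constructor
    · intro h
      obtain ⟨x, x', hx, hx', h1, h2, h3⟩ := exists_threads (Q := fun i => (D i).S) (e := e)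
        (fun i y z h => (he i).map_S h) (fun i y z h => ((he i).S_iff y z).1 h) i h
      exact ⟨⟨fun j => x j.down, hx⟩, ⟨fun j => x' j.down, hx'⟩, h1, h2, h3⟩
    · rintro ⟨x, x', rfl, rfl, h⟩
      exact h i

end InvLimit

/-- In a compact space, a continuous map to a discrete space factors through one of the maps of
a sequence of successively finer continuous maps that together separate the points. -/
theorem exists_factor {L : Type*} [TopologicalSpace L] [CompactSpace L] {D : ℕ → Type*}
    [∀ i, TopologicalSpace (D i)] [∀ i, T2Space (D i)] {π : ∀ i, L → D i}
    (hπ : ∀ i, Continuous (π i)) (hsurj : ∀ i, Function.Surjective (π i))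
    (hnest : ∀ i x y, π (i + 1) x = π (i + 1) y → π i x = π i y)
    (hsep : ∀ x y, (∀ i, π i x = π i y) → x = y) {X : Type*} [TopologicalSpace X]
    [DiscreteTopology X] {f : L → X} (hf : Continuous f) (i₀ : ℕ) :
    ∃ i ≥ i₀, ∃ f₀ : D i → X, f = f₀ ∘ π i := by
  obtain ⟨i, hi⟩ : ∃ i, ∀ x y, π (i₀ + i) x = π (i₀ + i) y → f x = f y := by
    by_contra h
    push Not at h
    have hclosed : ∀ i, IsClosed {p : L × L | π (i₀ + i) p.1 = π (i₀ + i) p.2 ∧ f p.1 ≠ f p.2} := by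
      intro i
      refine (isClosed_eq ((hπ _).comp continuous_fst) ((hπ _).comp continuous_snd)).inter ?_
      exact (isClosed_discrete {q : X × X | q.1 ≠ q.2}).preimage (hf.prodMap hf)
    obtain ⟨p, hp⟩ := IsCompact.nonempty_iInter_of_sequence_nonempty_isCompact_isClosed
      (fun i => {p : L × L | π (i₀ + i) p.1 = π (i₀ + i) p.2 ∧ f p.1 ≠ f p.2})
      (fun i p hp => ⟨hnest _ _ _ hp.1, hp.2⟩)
      (fun i => by obtain ⟨x, y, hxy⟩ := h i; exact ⟨(x, y), hxy⟩) (hclosed 0).isCompact hclosed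
    rw [Set.mem_iInter] at hp
    have hlow : ∀ i, π i p.1 = π i p.2 := by
      intro i
      refine Nat.decreasingInduction (motive := fun j _ => π j p.1 = π j p.2)
        (fun j _ hj => hnest j _ _ hj) (hp i).1 (Nat.le_add_left i i₀)
    exact (hp 0).2 (congrArg f (hsep _ _ hlow))
  refine ⟨i₀ + i, Nat.le_add_right _ _, fun y => f (Function.surjInv (hsurj _) y), ?_⟩
  funext x
  exact hi _ _ (Function.surjInv_eq (hsurj _) _).symm

end TopStructure

namespace Fan

open Pt TopStructure

/-! ### Amalgamation -/

theorem IsPtEpi.comp {l m k n k' n' : ℕ} {g : Pt l m → Pt k n} {f : Pt k' n' → Pt l m}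
    (hg : IsPtEpi g) (hf : IsPtEpi f) : IsPtEpi (g ∘ f) :=
  IsEpi.comp (A := model k n) (B := model l m) (C := model k' n') hg hf

/-- Amalgamation follows from the Ramsey property: color the epimorphisms onto the common target by
whether they factor through each of the two given maps. A monochromatic family contains composites
with both maps, so each of its members factors through both. -/
theorem exists_amalgam {k n l m l' m' : ℕ} (hk : 0 < k) (hn : 0 < n) {g : Pt l m → Pt k n}
    {d : Pt l' m' → Pt k n} (hg : IsPtEpi g) (hd : IsPtEpi d) :
    ∃ N > 0, ∃ (h : Pt N N → Pt l m) (h' : Pt N N → Pt l' m'),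
      IsPtEpi h ∧ IsPtEpi h' ∧ g ∘ h = d ∘ h' := by
  have hm := (hg.pos hk hn).2
  have hm' := (hd.pos hk hn).2
  obtain ⟨a, ha⟩ := exists_isPtEpi_of_le (N := max l l') (M := max m m') hm
    (le_max_left l l') (le_max_left m m')
  obtain ⟨b, hb⟩ := exists_isPtEpi_of_le (N := max l l') (M := max m m') hm'
    (le_max_right l l') (le_max_right m m')
  obtain ⟨N, hN, hram⟩ := exists_ramsey (l := max l l') (m := max m m') hk hn
    (hm.trans_le (le_max_left m m')) (Prop × Prop)
  obtain ⟨f, hf, c, hc⟩ := hram fun x => (∃ h : Pt N N → Pt l m, IsPtEpi h ∧ g ∘ h = x,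
    ∃ h' : Pt N N → Pt l' m', IsPtEpi h' ∧ d ∘ h' = x)
  have h1 := hc (g ∘ a) (hg.comp ha)
  have h2 := hc (d ∘ b) (hd.comp hb)
  have h3 : ∃ h' : Pt N N → Pt l' m', IsPtEpi h' ∧ d ∘ h' = (g ∘ a) ∘ f :=
    (congrArg Prod.snd (h1.trans h2.symm)).mpr ⟨b ∘ f, hb.comp hf, rfl⟩
  obtain ⟨h', hh', heq⟩ := h3
  exact ⟨N, hN, a ∘ f, h', ha.comp hf, hh', heq.symm⟩

/-- Pairs of maps, from the standard fan with `m` branches of height `l` and from a given one, into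
a common standard fan, where all the numbers of branches and heights are at most `i`. -/
abbrev Task (i k n : ℕ) : Type :=
  Σ a : Fin (i + 1) × Fin (i + 1) × Fin (i + 1) × Fin (i + 1),
    (Pt a.1 a.2.1 → Pt a.2.2.1 a.2.2.2) × (Pt k n → Pt a.2.2.1 a.2.2.2)

/-- One step of the generic sequence: an epimorphism that solves all the amalgamation problems
below a given size. -/
theorem exists_generic_step {k n : ℕ} (hn : 0 < n) (i : ℕ) :
    ∃ N > 0, ∃ e : Pt N N → Pt k n, IsPtEpi e ∧ ∀ l ≤ i, ∀ m ≤ i, ∀ k' ≤ i, ∀ n' ≤ i, 0 < k' →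
      0 < n' → ∀ (g : Pt l m → Pt k' n') (d : Pt k n → Pt k' n'), IsPtEpi g → IsPtEpi d →
        ∃ h : Pt N N → Pt l m, IsPtEpi h ∧ g ∘ h = d ∘ e := by
  classical
  have key : ∀ s : Finset (Task i k n), ∃ N > 0, ∃ e : Pt N N → Pt k n, IsPtEpi e ∧
      ∀ τ ∈ s, 0 < (τ.1.2.2.1 : ℕ) → 0 < (τ.1.2.2.2 : ℕ) → IsPtEpi τ.2.1 → IsPtEpi τ.2.2 →
        ∃ h : Pt N N → Pt τ.1.1 τ.1.2.1, IsPtEpi h ∧ τ.2.1 ∘ h = τ.2.2 ∘ e := by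
    intro s
    induction s using Finset.induction_on with
    | empty =>
      obtain ⟨e, he⟩ := exists_isPtEpi_of_le (N := max k n) (M := max k n) hn (le_max_left k n)
        (le_max_right k n)
      exact ⟨max k n, hn.trans_le (le_max_right k n), e, he, fun τ hτ =>
        absurd hτ (Finset.notMem_empty τ)⟩
    | insert τ s _ ih =>
      obtain ⟨N, hN, e, he, hs⟩ := ih
      by_cases hτ : 0 < (τ.1.2.2.1 : ℕ) ∧ 0 < (τ.1.2.2.2 : ℕ) ∧ IsPtEpi τ.2.1 ∧ IsPtEpi τ.2.2
      · obtain ⟨N', hN', h, e', hh, he', heq⟩ :=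
          exists_amalgam hτ.1 hτ.2.1 hτ.2.2.1 (hτ.2.2.2.comp he)
        refine ⟨N', hN', e ∘ e', he.comp he', fun ρ hρ h1 h2 h3 h4 => ?_⟩
        rcases Finset.mem_insert.1 hρ with rfl | hρ
        · exact ⟨h, hh, heq⟩
        · obtain ⟨h', hh', heq'⟩ := hs ρ hρ h1 h2 h3 h4
          refine ⟨h' ∘ e', hh'.comp he', ?_⟩
          rw [← Function.comp_assoc, heq', Function.comp_assoc]
      · refine ⟨N, hN, e, he, fun ρ hρ h1 h2 h3 h4 => ?_⟩
        rcases Finset.mem_insert.1 hρ with rfl | hρ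
        · exact absurd ⟨h1, h2, h3, h4⟩ hτ
        · exact hs ρ hρ h1 h2 h3 h4
  have : Fintype (Task i k n) := Fintype.ofFinite _
  obtain ⟨N, hN, e, he, hall⟩ := key Finset.univ
  refine ⟨N, hN, e, he, fun l hl m hm k' hk' n' hn' h1 h2 g d hg hd => ?_⟩
  exact hall ⟨(⟨l, Nat.lt_succ_of_le hl⟩, ⟨m, Nat.lt_succ_of_le hm⟩, ⟨k', Nat.lt_succ_of_le hk'⟩,
    ⟨n', Nat.lt_succ_of_le hn'⟩), g, d⟩ (Finset.mem_univ _) h1 h2 hg hd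

/-- The generic sequence of standard fans: the `i`-th bonding map solves the amalgamation problems
whose fans have at most `i` branches of height at most `i`. -/
theorem exists_generic_sequence : ∃ (N : ℕ → ℕ)
    (e : ∀ i, Pt (N (i + 1)) (N (i + 1)) → Pt (N i) (N i)), N 0 = 1 ∧ (∀ i, 0 < N i) ∧
    (∀ i, IsPtEpi (e i)) ∧ ∀ i, ∀ l ≤ i, ∀ m ≤ i, ∀ k ≤ i, ∀ n ≤ i, 0 < k → 0 < n →
      ∀ (g : Pt l m → Pt k n) (d : Pt (N i) (N i) → Pt k n), IsPtEpi g → IsPtEpi d →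
        ∃ h : Pt (N (i + 1)) (N (i + 1)) → Pt l m, IsPtEpi h ∧ g ∘ h = d ∘ e i := by
  have step : ∀ (k : {N : ℕ // 0 < N}) (i : ℕ), ∃ (N : {N : ℕ // 0 < N})
      (e : Pt N.1 N.1 → Pt k.1 k.1), IsPtEpi e ∧ ∀ l ≤ i, ∀ m ≤ i, ∀ k' ≤ i, ∀ n' ≤ i, 0 < k' →
      0 < n' → ∀ (g : Pt l m → Pt k' n') (d : Pt k.1 k.1 → Pt k' n'), IsPtEpi g → IsPtEpi d →
        ∃ h : Pt N.1 N.1 → Pt l m, IsPtEpi h ∧ g ∘ h = d ∘ e := by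
    intro k i
    obtain ⟨N, hN, e, h⟩ := exists_generic_step (k := k.1) k.2 i
    exact ⟨⟨N, hN⟩, e, h⟩
  choose N e he h using step
  let seq : ℕ → {N : ℕ // 0 < N} := fun i => Nat.rec ⟨1, one_pos⟩ (fun i k => N k i) i
  exact ⟨fun i => (seq i).1, fun i => e (seq i) i, rfl, fun i => (seq i).2,
    fun i => he (seq i) i, fun i => h (seq i) i⟩

/-! ### The generic limit -/

/-- A topological structure with epimorphisms `π i` onto standard fans that determine it, through
which all continuous maps to finite discrete spaces factor, and such that every epimorphism between
standard fans has the lifting property. -/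
structure IsGenericLimit (L : TopStructure.{u}) (N : ℕ → ℕ) (π : ∀ i, L → model (N i) (N i)) :
    Prop where
  pos : ∀ i, 0 < N i
  isEpi : ∀ i, IsEpi (π i)
  separates : ∀ x y, (∀ i, π i x = π i y) → x = y
  R_of_forall : ∀ x y, (∀ i, (model (N i) (N i)).R (π i x) (π i y)) → L.R x y
  S_of_forall : ∀ x y, (∀ i, (model (N i) (N i)).S (π i x) (π i y)) → L.S x y
  factor : ∀ (X : Type) [TopologicalSpace X] [DiscreteTopology X] (f : L → X),
    Continuous f → ∃ i, ∃ f₀ : model (N i) (N i) → X, f = f₀ ∘ π i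
  lift : ∀ l m k n, 0 < k → 0 < n → ∀ (g : model l m → model k n) (φ : L → model k n),
    IsEpi g → IsEpi φ → ∃ φ' : L → model l m, IsEpi φ' ∧ g ∘ φ' = φ

/-- The limit of the generic sequence. An epimorphism onto a standard fan factors through a late term
of the sequence, and the next bonding map solves the lifting problem. -/
theorem exists_isGenericLimit :
    ∃ (L : TopStructure.{u}) (N : ℕ → ℕ) (π : ∀ i, L → model (N i) (N i)),
      IsGenericLimit L N π ∧ N 0 = 1 := by
  obtain ⟨N, e, h0, hpos, he, hgen⟩ := exists_generic_sequence
  have he' : ∀ i, IsEpi (B := model (N (i + 1)) (N (i + 1))) (A := model (N i) (N i)) (e i) := he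
  let L := invLimit.{u} (fun i => model (N i) (N i)) e fun i => (he' i).continuous
  let π : ∀ i, L → model (N i) (N i) := fun i =>
    Thread.proj (D := fun i => model (N i) (N i)) (e := e) i
  have hπ : ∀ i, IsEpi (π i) := isEpi_proj he'
  have hproj : ∀ i x, e i (π (i + 1) x) = π i x := fun i x =>
    Thread.proj_succ (D := fun i => model (N i) (N i)) (e := e) i x
  have hfactor : ∀ (X : Type) [TopologicalSpace X] [DiscreteTopology X] (f : L → X),
      Continuous f → ∀ i₀, ∃ i ≥ i₀, ∃ f₀ : model (N i) (N i) → X, f = f₀ ∘ π i := by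
    intro X _ _ f hf i₀
    refine exists_factor (π := π) (fun i => (hπ i).continuous) (fun i => (hπ i).surjective) ?_
      (fun x y h => Thread.ext h) hf i₀
    intro i x y h
    rw [← hproj i x, ← hproj i y, h]
  refine ⟨L, N, π, ⟨hpos, hπ, fun x y h => Thread.ext h, fun x y h => h, fun x y h => h,
    fun X _ _ f hf => ?_, fun l m k n hk hn g φ hg hφ => ?_⟩, h0⟩
  · obtain ⟨i, _, h⟩ := hfactor X f hf 0
    exact ⟨i, h⟩
  · obtain ⟨i, hi, d, hd⟩ := hfactor _ φ hφ.continuous (max (max l m) (max k n))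
    have hdepi : IsEpi d := by
      refine IsEpi.of_comp continuous_of_discreteTopology ?_ (hπ i)
      rw [← hd]; exact hφ
    obtain ⟨h, hh, heq⟩ := hgen i l (by omega) m (by omega) k (by omega) n (by omega) hk hn g d
      hg hdepi
    refine ⟨h ∘ π (i + 1), IsEpi.comp (A := model l m) hh (hπ (i + 1)), ?_⟩
    rw [hd]
    funext x
    have h1 := congrFun heq (π (i + 1) x)
    simp only [Function.comp] at h1 ⊢
    rw [h1, hproj]

/-- A state of the back-and-forth argument: two epimorphisms onto the same standard fan. -/
structure EpiPair (L : TopStructure.{u}) where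
  /-- The height of the target. -/
  height : ℕ
  /-- The number of branches of the target. -/
  width : ℕ
  height_pos : 0 < height
  width_pos : 0 < width
  /-- The first epimorphism. -/
  fst : L → model height width
  /-- The second epimorphism. -/
  snd : L → model height width
  isEpi_fst : IsEpi fst
  isEpi_snd : IsEpi snd

namespace IsGenericLimit

variable {L : TopStructure.{u}} {N : ℕ → ℕ} {π : ∀ i, L → model (N i) (N i)}

/-- An epimorphism and a projection factor through a common finer projection. -/
theorem exists_refine (hL : IsGenericLimit L N π) {k n : ℕ} (α : L → model k n) (hα : IsEpi α)
    (i : ℕ) : ∃ j, ∃ d : model (N j) (N j) → model k n,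
      ∃ c : model (N j) (N j) → model (N i) (N i), IsEpi d ∧ α = d ∘ π j ∧ π i = c ∘ π j := by
  obtain ⟨j, f₀, hf₀⟩ := hL.factor (model k n × model (N i) (N i)) (fun x => (α x, π i x))
    (hα.continuous.prodMk (hL.isEpi i).continuous)
  have h1 : α = (Prod.fst ∘ f₀) ∘ π j := by
    funext x; exact congrArg Prod.fst (congrFun hf₀ x)
  have h2 : π i = (Prod.snd ∘ f₀) ∘ π j := by
    funext x; exact congrArg Prod.snd (congrFun hf₀ x)
  refine ⟨j, _, _, ?_, h1, h2⟩
  exact IsEpi.of_comp continuous_of_discreteTopology (h1 ▸ hα) (hL.isEpi j)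

/-- One step forth and one step back. -/
theorem exists_step (hL : IsGenericLimit L N π) (s : EpiPair L) (i : ℕ) :
    ∃ (s' : EpiPair L) (b : model s'.height s'.width → model s.height s.width)
      (c c' : model s'.height s'.width → model (N i) (N i)),
      s.fst = b ∘ s'.fst ∧ s.snd = b ∘ s'.snd ∧ π i = c ∘ s'.fst ∧ π i = c' ∘ s'.snd := by
  obtain ⟨j, d, c, hd, h1, h2⟩ := hL.exists_refine s.fst s.isEpi_fst i
  obtain ⟨β, hβ, h3⟩ := hL.lift _ _ _ _ s.height_pos s.width_pos d s.snd hd s.isEpi_snd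
  obtain ⟨j', d', c', hd', h4, h5⟩ := hL.exists_refine β hβ i
  obtain ⟨α, hα, h6⟩ := hL.lift _ _ _ _ (hL.pos j) (hL.pos j) d' (π j) hd' (hL.isEpi j)
  refine ⟨⟨N j', N j', hL.pos j', hL.pos j', α, π j', hα, hL.isEpi j'⟩, d ∘ d', c ∘ d', c', ?_, ?_,
    ?_, h5⟩
  · rw [h1, ← h6]; rfl
  · rw [← h3, h4]; rfl
  · dsimp only
    rw [h2]
    rw [← h6]; rfl

/-- Projective ultrahomogeneity for standard fans, by a back-and-forth argument. -/
theorem exists_isIso (hL : IsGenericLimit L N π) {k n : ℕ} (hk : 0 < k) (hn : 0 < n)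
    {φ₁ φ₂ : L → model k n} (h₁ : IsEpi φ₁) (h₂ : IsEpi φ₂) :
    ∃ ψ : L → L, IsIso ψ ∧ φ₂ = φ₁ ∘ ψ := by
  obtain ⟨H, W, α, β, hα, hβ, b, c, c', h0, hαs, hβs, hcα, hcβ⟩ : ∃ (H W : ℕ → ℕ)
      (α β : ∀ i, L → model (H i) (W i)) (_ : ∀ i, IsEpi (α i)) (_ : ∀ i, IsEpi (β i))
      (b : ∀ i, model (H (i + 1)) (W (i + 1)) → model (H i) (W i))
      (c c' : ∀ i, model (H (i + 1)) (W (i + 1)) → model (N i) (N i)),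
      (∀ x y, α 0 y = β 0 x → φ₂ x = φ₁ y) ∧ (∀ i x, α i x = b i (α (i + 1) x)) ∧
      (∀ i x, β i x = b i (β (i + 1) x)) ∧ (∀ i, π i = c i ∘ α (i + 1)) ∧
      ∀ i, π i = c' i ∘ β (i + 1) := by
    choose next b c c' hfst hsnd hc hc' using hL.exists_step
    let s : ℕ → EpiPair L := fun i =>
      Nat.rec ⟨k, n, hk, hn, φ₁, φ₂, h₁, h₂⟩ (fun i s => next s i) i
    exact ⟨fun i => (s i).height, fun i => (s i).width, fun i => (s i).fst, fun i => (s i).snd,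
      fun i => (s i).isEpi_fst, fun i => (s i).isEpi_snd,
      fun i => b (s i) i, fun i => c (s i) i, fun i => c' (s i) i, fun x y h => h.symm,
      fun i x => congrFun (hfst (s i) i) x, fun i x => congrFun (hsnd (s i) i) x,
      fun i => hc (s i) i, fun i => hc' (s i) i⟩
  have hcepi : ∀ i, IsEpi (c i) := fun i =>
    IsEpi.of_comp continuous_of_discreteTopology (hcα i ▸ hL.isEpi i) (hα (i + 1))
  have hcepi' : ∀ i, IsEpi (c' i) := fun i =>
    IsEpi.of_comp continuous_of_discreteTopology (hcβ i ▸ hL.isEpi i) (hβ (i + 1))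
  have hsepα : ∀ x y, (∀ i, α i x = α i y) → x = y := fun x y h =>
    hL.separates x y fun i => by rw [hcα i, Function.comp, Function.comp, h]
  have hsepβ : ∀ x y, (∀ i, β i x = β i y) → x = y := fun x y h =>
    hL.separates x y fun i => by rw [hcβ i, Function.comp, Function.comp, h]
  -- Corresponding points: by compactness each point matches a point of the other side at all stages.
  have hmatch : ∀ {γ δ : ∀ i, L → model (H i) (W i)}, (∀ i, IsEpi (γ i)) →
      (∀ i x, γ i x = b i (γ (i + 1) x)) → (∀ i x, δ i x = b i (δ (i + 1) x)) →
      ∀ x, ∃ y, ∀ i, γ i y = δ i x := by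
    intro γ δ hγ hγs hδs x
    have hcl : ∀ i, IsClosed {y | γ i y = δ i x} := fun i =>
      isClosed_eq (hγ i).continuous continuous_const
    obtain ⟨y, hy⟩ := IsCompact.nonempty_iInter_of_sequence_nonempty_isCompact_isClosed
      (fun i => {y | γ i y = δ i x})
      (fun i y (hy : γ (i + 1) y = δ (i + 1) x) => show γ i y = δ i x by rw [hγs, hy, ← hδs])
      (fun i => (hγ i).surjective _) (hcl 0).isCompact hcl
    exact ⟨y, fun i => Set.mem_iInter.1 hy i⟩
  choose ψ hψ using hmatch hα hαs hβs
  have hbij : Function.Bijective ψ := by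
    refine ⟨fun x y hxy => hsepβ x y fun i => ?_, fun y => ?_⟩
    · rw [← hψ x, ← hψ y, hxy]
    · obtain ⟨x, hx⟩ := hmatch hβ hβs hαs y
      exact ⟨x, hsepα _ _ fun i => by rw [hψ, hx]⟩
  have hcont : Continuous ψ := by
    have hemb : Topology.IsClosedEmbedding fun x i => α i x :=
      (continuous_pi fun i => (hα i).continuous).isClosedEmbedding fun x y h =>
        hsepα x y fun i => congrFun h i
    rw [hemb.isInducing.continuous_iff]
    refine continuous_pi fun i => ?_
    have : (fun x => α i (ψ x)) = β i := funext fun x => hψ x i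
    simpa [Function.comp_def, this] using (hβ i).continuous
  refine ⟨ψ, isIso_of_bijective hcont hbij (fun x y => ⟨fun h => ?_, fun h => ?_⟩)
    (fun x y => ⟨fun h => ?_, fun h => ?_⟩), ?_⟩
  · refine hL.R_of_forall _ _ fun i => ?_
    rw [hcβ i]
    refine (hcepi' i).map_R ?_
    rw [← hψ, ← hψ]
    exact (hα (i + 1)).map_R h
  · refine hL.R_of_forall _ _ fun i => ?_
    rw [hcα i]
    refine (hcepi i).map_R ?_
    rw [hψ, hψ]
    exact (hβ (i + 1)).map_R h
  · refine hL.S_of_forall _ _ fun i => ?_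
    rw [hcβ i]
    refine (hcepi' i).map_S ?_
    rw [← hψ, ← hψ]
    exact (hα (i + 1)).map_S h
  · refine hL.S_of_forall _ _ fun i => ?_
    rw [hcα i]
    refine (hcepi i).map_S ?_
    rw [hψ, hψ]
    exact (hβ (i + 1)).map_S h
  · funext x
    exact h0 _ _ (hψ x 0)

end IsGenericLimit

end Fan

namespace TopStructure

open Filter Topology

/-! ### The topology of the automorphism group -/

/-- An isomorphism of a structure with itself as an element of the automorphism group. -/
noncomputable def IsIso.toAut {L : TopStructure.{u}} {ψ : L → L} (h : IsIso ψ) : L.Aut :=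
  ⟨Continuous.homeoOfEquivCompactToT2 (f := Equiv.ofBijective ψ h.2) h.1.continuous, h⟩

/-- Every neighborhood of the identity contains the automorphisms that preserve finitely many
suitable clopen sets. -/
theorem exists_isClopen_of_mem_nhds_one {L : TopStructure.{u}} {V : Set L.Aut} (hV : V ∈ 𝓝 1) :
    ∃ t : Set (TopologicalSpace.Clopens L), t.Finite ∧
      ∀ h : L.Aut, (∀ C ∈ t, ∀ x ∈ C, h.1 x ∈ C) → h ∈ V := by
  have hle : (⨅ C : TopologicalSpace.Clopens L, 𝓟 {h : L.Aut | ∀ x ∈ C, h.1 x ∈ C}) ≤ 𝓝 1 := by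
    rw [nhds_induced, ← tendsto_iff_comap, ContinuousMap.tendsto_nhds_compactOpen]
    intro K hK U hU hKU
    obtain ⟨C, hC, hKC, hCU⟩ := exists_clopen_of_closed_subset_open hK.isClosed hU
      (fun x hx => hKU hx)
    refine mem_of_superset (mem_iInf_of_mem ⟨C, hC⟩ (mem_principal_self _)) fun h hh x hx => ?_
    exact hCU (hh x (hKC hx))
  obtain ⟨t, ht, htV⟩ := (hasBasis_iInf_principal_finite _).mem_iff.1 (hle hV)
  exact ⟨t, ht, fun h hh => htV (Set.mem_iInter₂.2 hh)⟩

end TopStructure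

namespace Fan

open Filter Topology TopStructure

/-! ### Extreme amenability from the Ramsey property -/

/-- The properties of a projective Fraïssé limit of the ordered fans, stated for the standard fans
of positive height and width. -/
structure IsStandardLimit (L : TopStructure.{u}) : Prop where
  universal : ∀ N > 0, ∃ φ : L → model N N, IsEpi φ
  factor : ∀ (X : Type) [TopologicalSpace X] [DiscreteTopology X] [Finite X] (f : L → X),
    Continuous f → ∃ k > 0, ∃ n > 0, ∃ φ : L → model k n, IsEpi φ ∧
      ∃ f₀ : model k n → X, f = f₀ ∘ φ
  ultrahomogeneous : ∀ k > 0, ∀ n > 0, ∀ φ₁ φ₂ : L → model k n, IsEpi φ₁ → IsEpi φ₂ →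
    ∃ ψ : L → L, IsIso ψ ∧ φ₂ = φ₁ ∘ ψ

theorem isEpi_comp_aut {L A : TopStructure} {φ : L → A} (hφ : IsEpi φ) (g : L.Aut) :
    IsEpi (φ ∘ g.1) :=
  IsEpi.comp hφ g.2.1

namespace IsStandardLimit

variable {L : TopStructure.{u}}

/-- The stabilizers of the epimorphisms onto standard fans form a neighborhood basis of the
identity. -/
theorem exists_stabilizer_subset (hL : IsStandardLimit L) {V : Set L.Aut} (hV : V ∈ 𝓝 1) :
    ∃ k > 0, ∃ n > 0, ∃ φ : L → model k n, IsEpi φ ∧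
      ∀ h : L.Aut, (∀ x, φ (h.1 x) = φ x) → h ∈ V := by
  obtain ⟨t, ht, htV⟩ := exists_isClopen_of_mem_nhds_one hV
  have : Finite t := ht
  obtain ⟨m, ⟨c⟩⟩ := Finite.exists_equiv_fin t
  let f : L → Fin m → Bool := fun x i => ((c.symm i).1 : Set L).boolIndicator x
  have hf : Continuous f := continuous_pi fun i =>
    (continuous_boolIndicator_iff_isClopen _).2 (c.symm i).1.isClopen
  obtain ⟨k, hk, n, hn, φ, hφ, f₀, hf₀⟩ := hL.factor _ f hf
  refine ⟨k, hk, n, hn, φ, hφ, fun h hh => htV h fun C hC x hx => ?_⟩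
  have h1 : f (h.1 x) = f x := by
    rw [hf₀, Function.comp, Function.comp, hh]
  have h2 := congrFun h1 (c ⟨C, hC⟩)
  simp only [f, Equiv.symm_apply_apply] at h2
  rw [← SetLike.mem_coe, Set.mem_iff_boolIndicator] at hx ⊢
  rw [h2, hx]

section Action

variable {X : Type v} [UniformSpace X] [CompactSpace X] [MulAction L.Aut X] [ContinuousSMul L.Aut X]

/-- Automorphisms near the identity move all the points of a compact space only a little. -/
theorem eventually_smul_mem {W : Set (X × X)} (hW : W ∈ uniformity X) :
    {v : L.Aut | ∀ x : X, (v • x, x) ∈ W} ∈ 𝓝 (1 : L.Aut) := by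
  have := isCompact_univ.eventually_forall_of_forall_eventually (x₀ := (1 : L.Aut))
    (K := (Set.univ : Set X)) (P := fun v x => (v • x, x) ∈ W) fun x _ => ?_
  · filter_upwards [this] with v hv x using hv x (Set.mem_univ x)
  · have hc : Continuous fun z : L.Aut × X => (z.1 • z.2, z.2) :=
      continuous_smul.prodMk continuous_snd
    refine hc.continuousAt.preimage_mem_nhds ?_
    simp only [one_smul]
    exact nhds_le_uniformity x hW

/-- Approximate fixed points. The orbit of a point is colored by the pieces of a cover by small
sets. Up to a small error, the color of `g • x₀` depends only on `φ ∘ g`, where `φ` is an epimorphism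
onto a standard fan whose stabilizer is small. So this is a coloring of epimorphisms, to which the
Ramsey property applies. -/
theorem exists_almost_fixed [Nonempty X] (hL : IsStandardLimit L) {W : Set (X × X)}
    (hW : W ∈ uniformity X) (F : Finset L.Aut) : ∃ x : X, ∀ g ∈ F, (g • x, x) ∈ W := by
  classical
  obtain ⟨W₁, hW₁, hsymm₁, hcomp₁⟩ := comp_symm_mem_uniformity_sets hW
  obtain ⟨W₂, hW₂, hsymm₂, hcomp₂⟩ := comp_symm_mem_uniformity_sets hW₁
  obtain ⟨t, htfin, ht⟩ := (isCompact_univ (X := X)).totallyBounded W₂ hW₂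
  have hcover : ∀ x : X, ∃ y : t, (x, y.1) ∈ W₂ := by
    intro x
    obtain ⟨y, hy, hxy⟩ := Set.mem_iUnion₂.1 (ht (Set.mem_univ x))
    exact ⟨⟨y, hy⟩, hxy⟩
  choose col hcol using hcover
  have : Finite t := htfin
  obtain ⟨x₀⟩ := ‹Nonempty X›
  obtain ⟨k, hk, n, hn, φ, hφ, hstab⟩ := hL.exists_stabilizer_subset (eventually_smul_mem hW₂)
  -- The automorphism `rep θ` represents the epimorphism `θ` as `φ ∘ rep θ`.
  have hlift : ∀ θ : L → model k n, ∃ g : L.Aut, IsEpi θ → ∀ x, φ (g.1 x) = θ x := by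
    intro θ
    by_cases hθ : IsEpi θ
    · obtain ⟨ψ, hψ, h⟩ := hL.ultrahomogeneous k hk n hn φ θ hφ hθ
      exact ⟨hψ.toAut, fun _ x => (congrFun h x).symm⟩
    · exact ⟨1, fun h => absurd h hθ⟩
  choose rep hrep using hlift
  have hcolor : ∀ g : L.Aut, (g • x₀, (col (rep (φ ∘ g.1) • x₀)).1) ∈ W₁ := by
    intro g
    refine hcomp₂ ⟨rep (φ ∘ g.1) • x₀, ?_, hcol _⟩
    have h1 := hstab (g * (rep (φ ∘ g.1))⁻¹) fun x => ?_
    · have := h1 (rep (φ ∘ g.1) • x₀)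
      rwa [← mul_smul, inv_mul_cancel_right] at this
    · have h2 := hrep (φ ∘ g.1) (isEpi_comp_aut hφ g) ((rep (φ ∘ g.1)).1.symm x)
      rw [Homeomorph.apply_symm_apply] at h2
      exact h2.symm
  -- All `φ ∘ g` with `g ∈ F'` factor through one epimorphism `ψ`, to which the Ramsey property
  -- is applied.
  let F' : Finset L.Aut := insert 1 F
  let f : L → Fin F'.card → model k n := fun z i => φ ((F'.equivFin.symm i).1.1 z)
  have hf : Continuous f := continuous_pi fun i =>
    hφ.continuous.comp (F'.equivFin.symm i).1.1.continuous
  obtain ⟨l, hl, m, hm, ψ, hψ, f₀, hf₀⟩ := hL.factor _ f hf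
  have hp : ∀ g ∈ F', ∃ p : model l m → model k n, IsEpi p ∧ φ ∘ g.1 = p ∘ ψ := by
    intro g hg
    have h1 : φ ∘ g.1 = (fun y => f₀ y (F'.equivFin ⟨g, hg⟩)) ∘ ψ := by
      funext z
      have := congrFun (congrFun hf₀ z) (F'.equivFin ⟨g, hg⟩)
      simpa [f] using this
    exact ⟨_, IsEpi.of_comp continuous_of_discreteTopology (h1 ▸ isEpi_comp_aut hφ g) hψ, h1⟩
  obtain ⟨N, hN, hram⟩ := exists_ramsey (k := k) (n := n) (l := l) (m := m) hk hn hm t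
  obtain ⟨χ, hχ⟩ := hL.universal N hN
  obtain ⟨r, hr, c, hc⟩ := hram fun p => col (rep (p ∘ χ) • x₀)
  -- Translating by `h` turns `ψ` into `r ∘ χ`, so all `g * h` get the same color.
  obtain ⟨h, hh, heq⟩ := hL.ultrahomogeneous l hl m hm ψ (r ∘ χ) hψ
    (IsEpi.comp (A := model l m) (B := model N N) hr hχ)
  have hmono : ∀ g ∈ F', (g • hh.toAut • x₀, c.1) ∈ W₁ := by
    intro g hg
    obtain ⟨p, hpepi, hpφ⟩ := hp g hg
    have h1 : φ ∘ (g * hh.toAut).1 = (p ∘ r) ∘ χ := by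
      funext z
      exact (congrFun hpφ (h z)).trans (congrArg p (congrFun heq z).symm)
    have h2 := hcolor (g * hh.toAut)
    rw [h1, mul_smul] at h2
    have h3 : col (rep ((p ∘ r) ∘ χ) • x₀) = c := hc p hpepi
    rwa [h3] at h2
  refine ⟨hh.toAut • x₀, fun g hg => hcomp₁ ⟨c.1, hmono g (Finset.mem_insert_of_mem hg), ?_⟩⟩
  have := hmono 1 (Finset.mem_insert_self 1 F)
  rw [one_smul] at this
  exact hsymm₁.symm _ _ this

end Action

/-- By compactness, approximate fixed points yield a fixed point. -/
theorem extremelyAmenable (hL : IsStandardLimit L) : ExtremelyAmenable.{u, v} L.Aut := by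
  classical
  intro X _ _ _ _ _ _
  let _ : UniformSpace X := uniformSpaceOfCompactR1
  obtain ⟨x, hx⟩ := CompactSpace.iInter_nonempty
    (t := fun p : L.Aut × {W : Set (X × X) // W ∈ uniformity X ∧ IsClosed W} =>
      {x : X | (p.1 • x, x) ∈ p.2.1})
    (fun p => p.2.2.2.preimage ((continuous_const_smul p.1).prodMk continuous_id)) fun s => by
      obtain ⟨x, hx⟩ := hL.exists_almost_fixed (X := X)
        ((Filter.biInter_finset_mem s).2 fun p _ => p.2.2.1) (s.image Prod.fst)
      refine ⟨x, Set.mem_iInter₂.2 fun p hp => ?_⟩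
      exact Set.mem_iInter₂.1 (hx p.1 (Finset.mem_image_of_mem _ hp)) p hp
  rw [Set.mem_iInter] at hx
  exact ⟨x, fun g => eq_of_uniformity_basis uniformity_hasBasis_closed fun {W} hW =>
    hx (g, ⟨W, hW⟩)⟩

end IsStandardLimit

end Fan

namespace Fan

open Pt TopStructure

/-! ### The standard fans are ordered fans -/

section StandardFan

variable {k n : ℕ}

/-- The vertex below a vertex. -/
def Pt.parent (x : Pt k n) : Pt k n := pt x.br (x.lev - 1)

theorem Pt.lev_parent (hn : 0 < n) (x : Pt k n) : x.parent.lev = x.lev - 1 :=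
  lev_pt (br_lt hn x) ((Nat.sub_le _ _).trans x.lev_le)

theorem Pt.br_parent {x : Pt k n} (hn : 0 < n) (hx : 1 < x.lev) : x.parent.br = x.br :=
  br_pt (br_lt hn x) ((Nat.sub_le _ _).trans x.lev_le) (by omega)

/-- The tree order of the standard fan. -/
def Pt.Below (x y : Pt k n) : Prop := x.lev = 0 ∨ (x.br = y.br ∧ x.lev ≤ y.lev)

/-- The graph of the standard fan. -/
def stdGraph (k n : ℕ) : SimpleGraph (Pt k n) where
  Adj x y := (0 < y.lev ∧ x = y.parent) ∨ (0 < x.lev ∧ y = x.parent)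
  symm := ⟨fun _ _ h => h.symm⟩
  loopless := ⟨fun x h => by
    rcases Nat.eq_zero_or_pos n with rfl | hn
    · have := x.prop
      omega
    · have h1 : 0 < x.lev ∧ x = x.parent := h.elim id id
      have h2 := congrArg lev h1.2
      rw [lev_parent hn] at h2
      omega⟩

theorem stdGraph_adj {x y : Pt k n} : (stdGraph k n).Adj x y ↔
    (0 < y.lev ∧ x = y.parent) ∨ (0 < x.lev ∧ y = x.parent) := Iff.rfl

theorem parent_pt {i t : ℕ} (hi : i < n) (ht : t < k) :
    (pt i (t + 1) : Pt k n).parent = pt i t := by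
  rw [parent, br_pt hi ht (Nat.succ_pos t), lev_pt hi ht, Nat.succ_sub_one]

theorem exists_path_stdGraph {i t : ℕ} (hi : i < n) (ht : t ≤ k) :
    ∃ p : (stdGraph k n).Walk (pt 0 0) (pt i t), p.IsPath ∧
      ∀ x, x ∈ p.support ↔ ∃ s ≤ t, x = pt i s := by
  induction t with
  | zero =>
    rw [pt_zero i]
    refine ⟨SimpleGraph.Walk.nil, by simp, fun x => ?_⟩
    simp
  | succ t ih =>
    obtain ⟨p, hp, hsupp⟩ := ih (by omega)
    have hadj : (stdGraph k n).Adj (pt i t) (pt i (t + 1)) :=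
      Or.inl ⟨by rw [lev_pt hi ht]; exact Nat.succ_pos t, (parent_pt hi ht).symm⟩
    refine ⟨p.concat hadj, hp.concat (fun h => ?_) hadj, fun x => ?_⟩
    · obtain ⟨s, hs, h⟩ := (hsupp _).1 h
      have := congrArg lev h
      rw [lev_pt hi ht, lev_pt hi (by omega)] at this
      omega
    · rw [SimpleGraph.Walk.support_concat, List.mem_append, hsupp,
        List.mem_singleton]
      constructor
      · rintro (⟨s, hs, h⟩ | h)
        exacts [⟨s, by omega, h⟩, ⟨t + 1, le_rfl, h⟩]
      · rintro ⟨s, hs, h⟩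
        rcases Nat.le_succ_iff.1 hs with hs | rfl
        exacts [Or.inl ⟨s, hs, h⟩, Or.inr h]

theorem isTree_stdGraph (hn : 0 < n) : (stdGraph k n).IsTree := by
  rw [SimpleGraph.isTree_iff_connected_and_card]
  constructor
  · rw [SimpleGraph.connected_iff_exists_forall_reachable]
    refine ⟨pt 0 0, fun x => ?_⟩
    obtain ⟨i, hi, t, ht, rfl⟩ := exists_pt hn x
    exact ⟨(exists_path_stdGraph hi ht).choose⟩
  · -- The edges correspond to the vertices other than the root.
    have hpos : ∀ x : Pt k n, x ≠ pt 0 0 → 0 < x.lev := fun x hx =>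
      Nat.pos_of_ne_zero fun h => hx (eq_root h)
    let f : {x : Pt k n // x ≠ pt 0 0} → (stdGraph k n).edgeSet := fun x =>
      ⟨s(x.1.parent, x.1), Or.inl ⟨hpos x.1 x.2, rfl⟩⟩
    have hf : Function.Bijective f := by
      constructor
      · rintro ⟨x, hx⟩ ⟨y, hy⟩ h
        have h1 : s(x.parent, x) = s(y.parent, y) := congrArg Subtype.val h
        rcases Sym2.eq_iff.1 h1 with ⟨_, h2⟩ | ⟨h2, h3⟩
        · exact Subtype.ext h2
        · have h4 := congrArg lev h2
          have h5 := congrArg lev h3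
          rw [lev_parent hn] at h4 h5
          have := hpos x hx
          omega
      · rintro ⟨e, he⟩
        induction e with
        | h x y =>
          have hne : ∀ x : Pt k n, 0 < x.lev → x ≠ pt 0 0 := by
            rintro x hx rfl
            rw [lev_root] at hx
            exact lt_irrefl 0 hx
          have he' : (stdGraph k n).Adj x y := he
          rcases stdGraph_adj.1 he' with ⟨h1, h2⟩ | ⟨h1, h2⟩
          · exact ⟨⟨y, hne y h1⟩, Subtype.ext (by simp only [f]; rw [h2])⟩
          · exact ⟨⟨x, hne x h1⟩, Subtype.ext (by simp only [f]; rw [h2, Sym2.eq_swap])⟩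
    classical
    rw [← Nat.card_congr (Equiv.ofBijective f hf), ← Finite.card_option,
      Nat.card_congr (Equiv.optionSubtypeNe (pt 0 0 : Pt k n))]

theorem treeLE_stdGraph_iff (hn : 0 < n) (x y : Pt k n) :
    TreeLE (stdGraph k n) (pt 0 0) x y ↔ x.Below y := by
  obtain ⟨i, hi, t, ht, rfl⟩ := exists_pt hn y
  obtain ⟨p, hp, hsupp⟩ := exists_path_stdGraph hi ht
  have h1 : TreeLE (stdGraph k n) (pt 0 0) x (pt i t) ↔ ∃ s ≤ t, x = pt i s := by
    rw [← hsupp]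
    constructor
    · rintro ⟨q, hq, hx⟩
      rwa [((isTree_stdGraph hn).existsUnique_path _ _).unique hq hp] at hx
    · exact fun hx => ⟨p, hp, hx⟩
  rw [h1]
  constructor
  · rintro ⟨s, hs, rfl⟩
    rcases Nat.eq_zero_or_pos s with rfl | h
    · exact Or.inl (by simp)
    · right
      rw [br_pt hi (hs.trans ht) h, br_pt hi ht (h.trans_le hs), lev_pt hi ht,
        lev_pt hi (hs.trans ht)]
      exact ⟨rfl, hs⟩
  · rintro (h | ⟨h2, h3⟩)
    · exact ⟨0, Nat.zero_le _, by rw [pt_zero]; exact eq_root h⟩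
    · rw [lev_pt hi ht] at h3
      refine ⟨x.lev, h3, ?_⟩
      rcases Nat.eq_zero_or_pos x.lev with h | h
      · rw [h, pt_zero]; exact eq_root h
      · rw [br_pt hi ht (h.trans_le h3)] at h2
        rw [← h2, pt_br_lev]

theorem isFan_stdGraph (hn : 0 < n) : IsFan (stdGraph k n) (pt 0 0) where
  isTree := isTree_stdGraph hn
  degree_le x hx := by
    refine (Set.encard_le_encard (t := {x.parent, pt x.br (x.lev + 1)}) fun y hy => ?_).trans
      ((Set.encard_insert_le _ _).trans (by rw [Set.encard_singleton]; norm_num))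
    rcases hy with ⟨h1, h2⟩ | ⟨_, h2⟩
    · right
      have h3 := congrArg lev h2
      rw [lev_parent hn] at h3
      have h4 : 0 < x.lev := Nat.pos_of_ne_zero fun h => hx (eq_root h)
      have h5 : x.br = y.br := by
        rw [h2]
        exact br_parent hn (by omega)
      rw [Set.mem_singleton_iff, h5, show x.lev + 1 = y.lev by omega, pt_br_lev]
    · exact Or.inl h2

/-- The vertex set of the `i`-th branch. -/
def branchSet (i : ℕ) : Set (Pt k n) := {x | x.lev = 0 ∨ x.br = i}

theorem isBranch_stdGraph_iff (hk : 0 < k) (hn : 0 < n) (b : Set (Pt k n)) :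
    IsBranch (stdGraph k n) (pt 0 0) b ↔ ∃ i < n, b = branchSet i := by
  have hle : TreeLE (stdGraph k n) (pt 0 0) = Below := by
    funext x y; exact propext (treeLE_stdGraph_iff hn x y)
  rw [IsBranch, hle]
  have hchain : ∀ i, IsChain Below (branchSet i : Set (Pt k n)) := by
    intro i x hx y hy _
    rcases hx with hx | hx
    · exact Or.inl (Or.inl hx)
    rcases hy with hy | hy
    · exact Or.inr (Or.inl hy)
    rcases le_total x.lev y.lev with h | h
    · exact Or.inl (Or.inr ⟨hx.trans hy.symm, h⟩)
    · exact Or.inr (Or.inr ⟨hy.trans hx.symm, h⟩)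
  constructor
  · rintro ⟨hb, hmax⟩
    obtain ⟨i, hi, hsub⟩ : ∃ i < n, b ⊆ branchSet i := by
      by_cases h : ∃ x ∈ b, 0 < x.lev
      · obtain ⟨x, hx, hx0⟩ := h
        refine ⟨x.br, br_lt hn x, fun y hy => ?_⟩
        by_cases hxy : x = y
        · exact Or.inr (hxy ▸ rfl)
        · rcases hb hx hy hxy with (h | h) | (h | h)
          · omega
          · exact Or.inr h.1.symm
          · exact Or.inl h
          · exact Or.inr h.1
      · push Not at h
        exact ⟨0, hn, fun y hy => Or.inl (Nat.le_zero.1 (h y hy))⟩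
    exact ⟨i, hi, hmax (hchain i) hsub⟩
  · rintro ⟨i, hi, rfl⟩
    refine ⟨hchain i, fun t ht hsub => hsub.antisymm fun x hx => ?_⟩
    have htop : (pt i k : Pt k n) ∈ t := hsub (Or.inr (br_pt hi le_rfl hk))
    by_cases hxy : x = pt i k
    · exact Or.inr (hxy ▸ br_pt hi le_rfl hk)
    · rcases ht hx htop hxy with (h | h) | (h | h)
      · exact Or.inl h
      · exact Or.inr (h.1.trans (br_pt hi le_rfl hk))
      · rw [lev_pt hi le_rfl] at h
        omega
      · exact Or.inr (h.1.symm.trans (br_pt hi le_rfl hk))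

theorem ncard_branchSet {i : ℕ} (hi : i < n) : (branchSet i : Set (Pt k n)).ncard = k + 1 := by
  have h : (branchSet i : Set (Pt k n)) = pt i '' Set.Iic k := by
    ext x
    constructor
    · rintro (h | rfl)
      · exact ⟨0, Nat.zero_le k, by rw [pt_zero, ← eq_root h]⟩
      · exact ⟨x.lev, x.lev_le, pt_br_lev x⟩
    · rintro ⟨t, ht, rfl⟩
      rcases Nat.eq_zero_or_pos t with rfl | h
      · exact Or.inl (by simp)
      · exact Or.inr (br_pt hi ht h)
  rw [h, Set.InjOn.ncard_image, Set.ncard_eq_toFinset_card', Set.toFinset_Iic, Nat.card_Iic]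
  intro s hs t ht hst
  rw [← lev_pt (n := n) hi hs, hst, lev_pt hi ht]

theorem immSucc_stdGraph_iff (hn : 0 < n) (x y : Pt k n) :
    ImmSucc (stdGraph k n) (pt 0 0) x y ↔
      y.lev = x.lev + 1 ∧ (x.lev = 0 ∨ x.br = y.br) := by
  unfold ImmSucc
  simp only [treeLE_stdGraph_iff hn]
  have hlev : ∀ x y : Pt k n, x.Below y → x ≠ y → x.lev < y.lev := by
    rintro x y (h | ⟨h1, h2⟩) hne
    · rw [h]
      refine Nat.pos_of_ne_zero fun h' => hne ?_
      rw [eq_root h, eq_root h']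
    · exact lt_of_le_of_ne h2 fun h => hne (Pt.ext h1 h)
  constructor
  · rintro ⟨h1, h2, h3⟩
    have h4 := hlev x y h1 h2
    have h5 : x.lev = 0 ∨ x.br = y.br := h1.imp_right And.left
    refine ⟨?_, h5⟩
    by_contra h6
    have hy := y.lev_le
    have hp : (pt y.br (x.lev + 1) : Pt k n).lev = x.lev + 1 := lev_pt (br_lt hn y) (by omega)
    have hb : (pt y.br (x.lev + 1) : Pt k n).br = y.br :=
      br_pt (br_lt hn y) (by omega) (by omega)
    refine h3 ⟨pt y.br (x.lev + 1), fun h => ?_, fun h => ?_, ?_, Or.inr ⟨hb, by omega⟩⟩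
    · have := congrArg lev h; omega
    · have := congrArg lev h; omega
    · exact h5.imp_right fun h => ⟨h.trans hb.symm, by omega⟩
  · rintro ⟨h1, h2⟩
    refine ⟨h2.imp_right fun h => ⟨h, by omega⟩, fun h => ?_, ?_⟩
    · rw [h] at h1; omega
    · rintro ⟨p, hpx, hpy, h3, h4⟩
      have := hlev x p h3 hpx.symm
      have := hlev p y h4 hpy
      omega

theorem model_mem_orderedFans (hk : 0 < k) (hn : 0 < n) : model k n ∈ orderedFans := by
  refine ⟨inferInstance, stdGraph k n, pt 0 0, isFan_stdGraph hn, ⟨k, fun b hb => ?_⟩,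
    fun x y => ?_, n, ?_⟩
  · obtain ⟨i, hi, rfl⟩ := (isBranch_stdGraph_iff hk hn b).1 hb
    exact ncard_branchSet hi
  · exact or_congr_right (immSucc_stdGraph_iff hn x y).symm
  · let f : Fin n → {b : Set (Pt k n) // IsBranch (stdGraph k n) (pt 0 0) b} := fun i =>
      ⟨branchSet i, (isBranch_stdGraph_iff hk hn _).2 ⟨i, i.2, rfl⟩⟩
    have hf : Function.Bijective f := by
      constructor
      · intro i j hij
        have h1 : (branchSet (i : ℕ) : Set (Pt k n)) = branchSet (j : ℕ) :=
          congrArg Subtype.val hij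
        have h2 : (pt i k : Pt k n) ∈ (branchSet (j : ℕ) : Set (Pt k n)) :=
          h1 ▸ Or.inr (br_pt i.2 le_rfl hk)
        rcases h2 with h2 | h2
        · rw [lev_pt i.2 le_rfl] at h2; omega
        · rw [br_pt i.2 le_rfl hk] at h2
          exact Fin.ext h2
      · rintro ⟨b, hb⟩
        obtain ⟨i, hi, rfl⟩ := (isBranch_stdGraph_iff hk hn b).1 hb
        exact ⟨⟨i, hi⟩, rfl⟩
    have hmem : ∀ (x : Pt k n) (i : Fin n), x ∈ (f i).1 ↔ x.lev = 0 ∨ x.br = i :=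
      fun x i => Iff.rfl
    have hS : ∀ x y : Pt k n, Pt.S x y ↔ ∃ i j : Fin n, i ≤ j ∧ x ∈ (f i).1 ∧ y ∈ (f j).1 := by
      intro x y
      simp only [hmem, Pt.S]
      constructor
      · rintro (h | h | h)
        · exact ⟨⟨br y, br_lt hn y⟩, ⟨br y, br_lt hn y⟩, le_rfl, Or.inl h, Or.inr rfl⟩
        · exact ⟨⟨br x, br_lt hn x⟩, ⟨br x, br_lt hn x⟩, le_rfl, Or.inr rfl, Or.inl h⟩
        · exact ⟨⟨br x, br_lt hn x⟩, ⟨br y, br_lt hn y⟩, h, Or.inr rfl, Or.inr rfl⟩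
      · rintro ⟨i, j, hij, h1 | h1, h2 | h2⟩
        · exact Or.inl h1
        · exact Or.inl h1
        · exact Or.inr (Or.inl h2)
        · right; right
          rw [h1, h2]
          exact hij
    exact ⟨Equiv.ofBijective f hf, hS⟩

end StandardFan

/-! ### The tree order of a fan -/

section TreeOrder

variable {V : Type u} {T : SimpleGraph V} {r : V}

/-- The vertices below `t` are the vertices of the path from the root to `t`. -/
theorem treeLE_iff_mem_support (hT : T.IsTree) {s t : V} {p : T.Walk r t} (hp : p.IsPath) :
    TreeLE T r s t ↔ s ∈ p.support := by
  constructor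
  · rintro ⟨q, hq, hs⟩
    rwa [(hT.existsUnique_path r t).unique hq hp] at hs
  · exact fun hs => ⟨p, hp, hs⟩

theorem treeLE_refl (hT : T.IsTree) (t : V) : TreeLE T r t t := by
  obtain ⟨p, hp⟩ := (hT.existsUnique_path r t).exists
  exact ⟨p, hp, p.end_mem_support⟩

theorem root_treeLE (hT : T.IsTree) (t : V) : TreeLE T r r t := by
  obtain ⟨p, hp⟩ := (hT.existsUnique_path r t).exists
  exact ⟨p, hp, p.start_mem_support⟩

theorem treeLE_trans (hT : T.IsTree) {s t w : V} (hst : TreeLE T r s t) (htw : TreeLE T r t w) :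
    TreeLE T r s w := by
  classical
  obtain ⟨p, hp, ht⟩ := htw
  rw [treeLE_iff_mem_support hT (hp.takeUntil ht)] at hst
  exact ⟨p, hp, p.support_takeUntil_subset_support ht hst⟩

theorem treeLE_antisymm (hT : T.IsTree) {s t : V} (hst : TreeLE T r s t) (hts : TreeLE T r t s) :
    s = t := by
  classical
  obtain ⟨p, hp, hs⟩ := hst
  obtain ⟨q, hq, ht⟩ := hts
  by_contra hne
  have h1 := SimpleGraph.Walk.length_takeUntil_lt_length hs hne
  have h2 := SimpleGraph.Walk.length_takeUntil_lt_length ht (Ne.symm hne)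
  rw [(hT.existsUnique_path r s).unique (hp.takeUntil hs) hq] at h1
  rw [(hT.existsUnique_path r t).unique (hq.takeUntil ht) hp] at h2
  omega

theorem treeLE_total_of_le (hT : T.IsTree) {s s' t : V} (hs : TreeLE T r s t)
    (hs' : TreeLE T r s' t) : TreeLE T r s s' ∨ TreeLE T r s' s := by
  classical
  obtain ⟨p, hp, hs⟩ := hs
  rw [treeLE_iff_mem_support hT hp] at hs'
  have h := p.take_spec hs
  rw [← h, SimpleGraph.Walk.mem_support_append_iff] at hs'
  rcases hs' with h' | h'
  · exact Or.inr ⟨_, hp.takeUntil hs, h'⟩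
  · left
    refine ⟨(p.takeUntil s hs).append ((p.dropUntil s hs).takeUntil s' h'), ?_, ?_⟩
    · refine SimpleGraph.Walk.IsPath.of_append_left (q := (p.dropUntil s hs).dropUntil s' h') ?_
      rw [← SimpleGraph.Walk.append_assoc, SimpleGraph.Walk.take_spec, h]
      exact hp
    · rw [SimpleGraph.Walk.mem_support_append_iff]
      exact Or.inl (SimpleGraph.Walk.end_mem_support _)

/-- Two paths that leave a vertex other than the root upwards take the same first edge, as the
degree is at most two. -/
theorem treeLE_total_of_append (hF : IsFan T r) {x y : V} (q : T.Walk x y) :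
    ∀ (p : T.Walk r x), x ≠ r → (p.append q).IsPath → ∀ (z : V) (q' : T.Walk x z),
      (p.append q').IsPath → TreeLE T r y z ∨ TreeLE T r z y := by
  induction q with
  | nil =>
    intro p _ hp z q' hq'
    left
    refine ⟨p.append q', hq', ?_⟩
    rw [SimpleGraph.Walk.mem_support_append_iff]
    exact Or.inl p.end_mem_support
  | @cons x y₁ y h q ih =>
    intro p hx hp z q' hq'
    cases q' with
    | nil =>
      right
      refine ⟨p.append (SimpleGraph.Walk.cons h q), hp, ?_⟩
      rw [SimpleGraph.Walk.mem_support_append_iff]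
      exact Or.inl p.end_mem_support
    | @cons _ z₁ _ h' q' =>
      have key : ∀ {a b : V} (h : T.Adj x a) (q : T.Walk a b),
          (p.append (SimpleGraph.Walk.cons h q)).IsPath → a ≠ p.penultimate := by
        intro a b h q hpath heq
        rw [SimpleGraph.Walk.isPath_def, SimpleGraph.Walk.support_append,
          SimpleGraph.Walk.support_cons, List.tail_cons, List.nodup_append] at hpath
        exact hpath.2.2 _ (p.getVert_mem_support _) _ (q.start_mem_support) heq.symm
      -- The neighbor of `x` below it and the two first steps would be three neighbors.
      have hy := key h q hp
      have hz := key h' q' hq'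
      have hnil : ¬ p.Nil := SimpleGraph.Walk.not_nil_of_ne (Ne.symm hx)
      have hpen := (p.adj_penultimate hnil).symm
      have heq : y₁ = z₁ := by
        by_contra hne
        have hsub : ({p.penultimate, y₁, z₁} : Set V) ⊆ T.neighborSet x := by
          rintro a (rfl | rfl | rfl)
          exacts [hpen, h, h']
        have h1 := (Set.encard_le_encard hsub).trans (hF.degree_le x hx)
        rw [Set.encard_insert_of_notMem (by
          rintro (h | h)
          exacts [hy h.symm, hz h.symm]), Set.encard_pair hne] at h1
        exact absurd h1 (by norm_num)
      subst heq
      have hr : y₁ ≠ r := by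
        rintro rfl
        rw [SimpleGraph.Walk.isPath_def, SimpleGraph.Walk.support_append,
          SimpleGraph.Walk.support_cons, List.tail_cons, List.nodup_append] at hp
        exact hp.2.2 _ p.start_mem_support _ q.start_mem_support rfl
      refine ih (p.concat h) hr ?_ z q' ?_
      · rwa [SimpleGraph.Walk.concat_append]
      · rwa [SimpleGraph.Walk.concat_append]

theorem treeLE_total_of_ge (hF : IsFan T r) {x y z : V} (hx : x ≠ r) (hy : TreeLE T r x y)
    (hz : TreeLE T r x z) : TreeLE T r y z ∨ TreeLE T r z y := by
  classical
  obtain ⟨p, hp, hxp⟩ := hy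
  obtain ⟨p', hp', hxp'⟩ := hz
  refine treeLE_total_of_append hF (p.dropUntil x hxp) (p.takeUntil x hxp) hx ?_ z
    (p'.dropUntil x hxp') ?_
  · rwa [SimpleGraph.Walk.take_spec]
  · rw [(hF.isTree.existsUnique_path r x).unique (hp.takeUntil hxp) (hp'.takeUntil hxp'),
      SimpleGraph.Walk.take_spec]
    exact hp'

/-! ### Branches and heights -/

theorem IsBranch.mem_of_treeLE (hT : T.IsTree) {b : Set V} (hb : IsBranch T r b) {s t : V}
    (ht : t ∈ b) (hst : TreeLE T r s t) : s ∈ b := by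
  have hchain : IsChain (TreeLE T r) (insert s b) := by
    refine hb.1.insert fun w hw _ => ?_
    by_cases h : t = w
    · exact Or.inl (h ▸ hst)
    · rcases hb.1 ht hw h with h | h
      · exact Or.inl (treeLE_trans hT hst h)
      · exact treeLE_total_of_le hT hst h
  rw [hb.2 hchain (Set.subset_insert s b)]
  exact Set.mem_insert s b

theorem exists_isBranch_mem (x : V) : ∃ b, IsBranch T r b ∧ x ∈ b := by
  obtain ⟨b, hb, hx⟩ := (IsChain.singleton (r := TreeLE T r) (a := x)).exists_maxChain
  exact ⟨b, hb, hx rfl⟩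

theorem IsBranch.total (hT : T.IsTree) {b : Set V} (hb : IsBranch T r b) {x y : V} (hx : x ∈ b)
    (hy : y ∈ b) : TreeLE T r x y ∨ TreeLE T r y x := by
  by_cases h : x = y
  · exact Or.inl (h ▸ treeLE_refl hT x)
  · exact hb.1 hx hy h

/-- Only the root lies on several branches. -/
theorem IsBranch.eq_of_mem (hF : IsFan T r) {b b' : Set V} (hb : IsBranch T r b)
    (hb' : IsBranch T r b') {x : V} (hx : x ≠ r) (hxb : x ∈ b) (hxb' : x ∈ b') : b = b' := by
  have hT := hF.isTree
  have hchain : IsChain (TreeLE T r) (b ∪ b') := by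
    have hcross : ∀ y ∈ b, ∀ z ∈ b', TreeLE T r y z ∨ TreeLE T r z y := by
      intro y hy z hz
      rcases hb.total hT hxb hy with h1 | h1 <;> rcases hb'.total hT hxb' hz with h2 | h2
      · exact treeLE_total_of_ge hF hx h1 h2
      · exact Or.inr (treeLE_trans hT h2 h1)
      · exact Or.inl (treeLE_trans hT h1 h2)
      · exact treeLE_total_of_le hT h1 h2
    rintro y (hy | hy) z (hz | hz) hne
    · exact hb.1 hy hz hne
    · exact hcross y hy z hz
    · exact (hcross z hz y hy).symm
    · exact hb'.1 hy hz hne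
  rw [hb.2 hchain Set.subset_union_left]
  exact (hb'.2 hchain Set.subset_union_right).symm

/-- The height of a vertex: the number of vertices strictly below it. -/
noncomputable def height (T : SimpleGraph V) (r : V) (x : V) : ℕ :=
  {y | TreeLE T r y x ∧ y ≠ x}.ncard

variable [Finite V]

theorem height_lt (hT : T.IsTree) {x y : V} (hxy : TreeLE T r x y) (hne : x ≠ y) :
    height T r x < height T r y := by
  refine Set.ncard_lt_ncard ⟨fun z hz => ⟨treeLE_trans hT hz.1 hxy, ?_⟩, fun h => ?_⟩
    (Set.toFinite _)
  · rintro rfl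
    exact hne (treeLE_antisymm hT hxy hz.1)
  · exact (h ⟨hxy, hne⟩ : _ ∧ x ≠ x).2 rfl

theorem height_root (hT : T.IsTree) : height T r r = 0 := by
  rw [height, Set.ncard_eq_zero]
  ext y
  simp only [Set.mem_ofPred_eq, Set.mem_empty_iff_false, iff_false, not_and, not_not]
  exact fun h => treeLE_antisymm hT h (root_treeLE hT y)

theorem height_eq_zero_iff (hT : T.IsTree) {x : V} : height T r x = 0 ↔ x = r := by
  constructor
  · intro h
    by_contra hne
    have := height_lt hT (root_treeLE hT x) (Ne.symm hne)
    omega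
  · rintro rfl
    exact height_root hT

section Branch

variable {b : Set V} {k : ℕ}

theorem IsBranch.treeLE_of_height_le (hT : T.IsTree) (hb : IsBranch T r b) {x y : V} (hx : x ∈ b)
    (hy : y ∈ b) (h : height T r x ≤ height T r y) : TreeLE T r x y := by
  rcases hb.total hT hx hy with h1 | h1
  · exact h1
  · by_cases hne : y = x
    · exact hne ▸ treeLE_refl hT _
    · have := height_lt hT h1 hne
      omega

theorem IsBranch.height_injOn (hT : T.IsTree) (hb : IsBranch T r b) :
    Set.InjOn (height T r) b := fun _ hx _ hy h =>
  treeLE_antisymm hT (hb.treeLE_of_height_le hT hx hy h.le) (hb.treeLE_of_height_le hT hy hx h.ge)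

theorem IsBranch.height_le (hT : T.IsTree) (hb : IsBranch T r b) (hk : b.ncard = k + 1) {x : V}
    (hx : x ∈ b) : height T r x ≤ k := by
  have h : {y | TreeLE T r y x ∧ y ≠ x} ⊂ b :=
    ⟨fun y hy => hb.mem_of_treeLE hT hx hy.1, fun h => (h hx).2 rfl⟩
  have := Set.ncard_lt_ncard h (Set.toFinite _)
  rw [height]
  omega

/-- On a branch with `k + 1` vertices each height up to `k` occurs, by counting. -/
theorem IsBranch.exists_height_eq (hT : T.IsTree) (hb : IsBranch T r b) (hk : b.ncard = k + 1)
    {t : ℕ} (ht : t ≤ k) : ∃ x ∈ b, height T r x = t := by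
  have h1 : height T r '' b = Set.Iic k := by
    refine Set.eq_of_subset_of_ncard_le ?_ ?_ (Set.finite_Iic k)
    · rintro _ ⟨x, hx, rfl⟩
      exact hb.height_le hT hk hx
    · rw [(hb.height_injOn hT).ncard_image, hk, Set.ncard_eq_toFinset_card', Set.toFinset_Iic,
        Nat.card_Iic]
  have h2 : t ∈ height T r '' b := h1 ▸ ht
  exact h2

theorem immSucc_iff (hT : T.IsTree) {s t : V} :
    ImmSucc T r s t ↔ TreeLE T r s t ∧ height T r t = height T r s + 1 := by
  constructor
  · rintro ⟨h1, h2, h3⟩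
    refine ⟨h1, ?_⟩
    have h4 := height_lt hT h1 h2
    by_contra h5
    obtain ⟨b, hb, htb⟩ := exists_isBranch_mem (T := T) (r := r) t
    have hsb := hb.mem_of_treeLE hT htb h1
    have hpos : 0 < b.ncard := (Set.ncard_pos (Set.toFinite _)).2 ⟨t, htb⟩
    have hcard : b.ncard = (b.ncard - 1) + 1 := by omega
    have hle := hb.height_le hT hcard htb
    obtain ⟨p, hp, hph⟩ := hb.exists_height_eq hT hcard (t := height T r s + 1) (by omega)
    refine h3 ⟨p, ?_, ?_, hb.treeLE_of_height_le hT hsb hp (by omega),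
      hb.treeLE_of_height_le hT hp htb (by omega)⟩
    · rintro rfl; omega
    · rintro rfl; omega
  · rintro ⟨h1, h2⟩
    refine ⟨h1, ?_, ?_⟩
    · rintro rfl; omega
    · rintro ⟨p, hps, hpt, h3, h4⟩
      have := height_lt hT h3 (Ne.symm hps)
      have := height_lt hT h4 hpt
      omega

end Branch

end TreeOrder

/-- An ordered fan is isomorphic to a standard one. The isomorphism maps a vertex to its branch and
its height. -/
theorem exists_equiv_model {A : TopStructure.{0}} (hA : A ∈ orderedFans) :
    ∃ (k n : ℕ) (E : A ≃ Pt k n), 0 < n ∧ (∀ x y, A.R x y ↔ Pt.R (E x) (E y)) ∧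
      ∀ x y, A.S x y ↔ Pt.S (E x) (E y) := by
  obtain ⟨hfin, T, r, hF, ⟨k, hk⟩, hR, n, a, hS⟩ := hA
  have hT := hF.isTree
  have hidx : ∀ x : A, ∃ i : Fin n, x ∈ (a i).1 := by
    intro x
    obtain ⟨b, hb, hx⟩ := exists_isBranch_mem (T := T) (r := r) x
    exact ⟨a.symm ⟨b, hb⟩, by rwa [Equiv.apply_symm_apply]⟩
  choose idx hidx using hidx
  have hn : 0 < n := (Nat.zero_le _).trans_lt (idx r).2
  have huniq : ∀ (x : A) (i : Fin n), x ≠ r → x ∈ (a i).1 → i = idx x := fun x i hx hxi =>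
    a.injective (Subtype.ext ((a i).2.eq_of_mem hF (a (idx x)).2 hx hxi (hidx x)))
  have hle : ∀ x : A, height T r x ≤ k := fun x =>
    (a (idx x)).2.height_le hT (hk _ (a (idx x)).2) (hidx x)
  have hroot : ∀ i, r ∈ (a i).1 := fun i => by
    obtain ⟨x, hx⟩ : (a i).1.Nonempty := by
      rw [← Set.ncard_pos (Set.toFinite _), hk _ (a i).2]
      exact Nat.succ_pos k
    exact (a i).2.mem_of_treeLE hT hx (root_treeLE hT x)
  let f : A → Pt k n := fun x => pt (idx x) (height T r x)
  have hlev : ∀ x, (f x).lev = height T r x := fun x => lev_pt (idx x).2 (hle x)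
  have hbr : ∀ x, x ≠ r → (f x).br = idx x := fun x hx =>
    br_pt (idx x).2 (hle x) (Nat.pos_of_ne_zero fun h => hx ((height_eq_zero_iff hT).1 h))
  have hzero : ∀ x, (f x).lev = 0 ↔ x = r := fun x => by rw [hlev, height_eq_zero_iff hT]
  have hsame : ∀ x y, x ≠ r → y ≠ r → (f x).br = (f y).br → y ∈ (a (idx x)).1 := by
    intro x y hx hy h
    rw [hbr x hx, hbr y hy] at h
    rw [Fin.ext h]
    exact hidx y
  have hbij : Function.Bijective f := by
    constructor
    · intro x y hxy
      by_cases hx : x = r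
      · rw [hx, eq_comm, ← hzero y, ← hxy, hzero, hx]
      · have hy : y ≠ r := fun hy => hx ((hzero x).1 (by rw [hxy, hzero, hy]))
        refine (a (idx x)).2.height_injOn hT (hidx x)
          (hsame x y hx hy (congrArg br hxy)) ?_
        rw [← hlev, ← hlev, hxy]
    · intro z
      obtain ⟨i, hi, t, ht, rfl⟩ := exists_pt hn z
      obtain ⟨x, hx, rfl⟩ := (a ⟨i, hi⟩).2.exists_height_eq hT (hk _ (a ⟨i, hi⟩).2) ht
      refine ⟨x, ?_⟩
      by_cases hxr : x = r
      · simp only [f]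
        rw [(height_eq_zero_iff hT).2 hxr, pt_zero, pt_zero i]
      · simp only [f]
        rw [← huniq x ⟨i, hi⟩ hxr hx]
  refine ⟨k, n, Equiv.ofBijective f hbij, hn, fun x y => ?_, fun x y => ?_⟩
  · rw [hR, immSucc_iff hT, Pt.R, Equiv.ofBijective_apply, Equiv.ofBijective_apply,
      hbij.1.eq_iff, hlev, hlev, height_eq_zero_iff hT]
    refine or_congr_right ⟨fun ⟨h1, h2⟩ => ⟨h2, ?_⟩, fun ⟨h1, h2⟩ => ⟨?_, h1⟩⟩
    · by_cases hx : x = r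
      · exact Or.inl hx
      · right
        have hy : y ≠ r := by
          rintro rfl
          exact hx (treeLE_antisymm hT h1 (root_treeLE hT x))
        rw [hbr x hx, hbr y hy, huniq x (idx y) hx ((a (idx y)).2.mem_of_treeLE hT (hidx y) h1)]
    · rcases h2 with rfl | h2
      · exact root_treeLE hT y
      · by_cases hx : x = r
        · rw [hx]; exact root_treeLE hT y
        have hy : y ≠ r := by
          rintro rfl
          rw [height_root hT] at h1
          omega
        exact (a (idx x)).2.treeLE_of_height_le hT (hidx x) (hsame x y hx hy h2) (by omega)
  · rw [hS, Pt.S, Equiv.ofBijective_apply, Equiv.ofBijective_apply, hzero, hzero]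
    constructor
    · rintro ⟨i, j, hij, hx, hy⟩
      by_cases hxr : x = r
      · exact Or.inl hxr
      by_cases hyr : y = r
      · exact Or.inr (Or.inl hyr)
      right; right
      rw [hbr x hxr, hbr y hyr, ← huniq x i hxr hx, ← huniq y j hyr hy]
      exact hij
    · intro h
      by_cases hxr : x = r
      · exact ⟨idx y, idx y, le_rfl, by rw [hxr]; exact hroot _, hidx y⟩
      by_cases hyr : y = r
      · exact ⟨idx x, idx x, le_rfl, hidx x, by rw [hyr]; exact hroot _⟩
      have h := (h.resolve_left hxr).resolve_left hyr
      rw [hbr x hxr, hbr y hyr] at h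
      exact ⟨idx x, idx y, h, hidx x, hidx y⟩

/-! ### From standard fans to ordered fans -/

/-- A bijection that preserves and reflects the relations identifies a finite structure with a
standard fan. -/
theorem isEpi_equiv_model {A : TopStructure.{0}} [Finite A] {k n : ℕ} {E : A ≃ Pt k n}
    (hR : ∀ x y, A.R x y ↔ Pt.R (E x) (E y)) (hS : ∀ x y, A.S x y ↔ Pt.S (E x) (E y)) :
    IsEpi (A := model k n) (B := A) E ∧ IsEpi (A := A) (B := model k n) E.symm := by
  refine ⟨⟨continuous_of_discreteTopology, E.surjective, fun x y => ?_, fun x y => ?_⟩,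
    ⟨continuous_of_discreteTopology, E.symm.surjective, fun x y => ?_, fun x y => ?_⟩⟩
  · refine ⟨fun h => ?_, ?_⟩
    · obtain ⟨a, rfl⟩ := E.surjective x
      obtain ⟨b, rfl⟩ := E.surjective y
      exact ⟨a, b, rfl, rfl, (hR a b).2 h⟩
    · rintro ⟨a, b, rfl, rfl, h⟩
      exact (hR a b).1 h
  · refine ⟨fun h => ?_, ?_⟩
    · obtain ⟨a, rfl⟩ := E.surjective x
      obtain ⟨b, rfl⟩ := E.surjective y
      exact ⟨a, b, rfl, rfl, (hS a b).2 h⟩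
    · rintro ⟨a, b, rfl, rfl, h⟩
      exact (hS a b).1 h
  · refine ⟨fun h => ⟨E x, E y, E.symm_apply_apply x, E.symm_apply_apply y, (hR x y).1 h⟩, ?_⟩
    rintro ⟨a, b, rfl, rfl, h⟩
    obtain ⟨a, rfl⟩ := E.surjective a
    obtain ⟨b, rfl⟩ := E.surjective b
    exact (congrArg₂ A.R (E.symm_apply_apply a) (E.symm_apply_apply b)).mpr ((hR a b).2 h)
  · refine ⟨fun h => ⟨E x, E y, E.symm_apply_apply x, E.symm_apply_apply y, (hS x y).1 h⟩, ?_⟩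
    rintro ⟨a, b, rfl, rfl, h⟩
    obtain ⟨a, rfl⟩ := E.surjective a
    obtain ⟨b, rfl⟩ := E.surjective b
    exact (congrArg₂ A.S (E.symm_apply_apply a) (E.symm_apply_apply b)).mpr ((hS a b).2 h)

/-- Each ordered fan is isomorphic to a standard fan. -/
theorem exists_isEpi_equiv_model {A : TopStructure.{0}} (hA : A ∈ orderedFans) :
    ∃ (k n : ℕ) (E : A ≃ model k n), 0 < n ∧ IsEpi (A := model k n) (B := A) E ∧
      IsEpi (A := A) (B := model k n) E.symm := by
  have : Finite A := hA.1
  obtain ⟨k, n, E, hn, hR, hS⟩ := exists_equiv_model hA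
  exact ⟨k, n, E, hn, isEpi_equiv_model hR hS⟩

instance (n : ℕ) : Subsingleton (model 0 n) :=
  ⟨fun x y => (eq_root (Nat.le_zero.1 (Pt.lev_le x))).trans
    (eq_root (Nat.le_zero.1 (Pt.lev_le y))).symm⟩

theorem nontrivial_model {k n : ℕ} (hk : 0 < k) (hn : 0 < n) : Nontrivial (model k n) :=
  ⟨(pt 0 0 : Pt k n), (pt 0 1 : Pt k n), fun h => by
    have h1 := congrArg Pt.lev h
    rw [lev_root, lev_pt hn hk] at h1
    omega⟩

/-- A fan of height `0` is a point, and it is an epimorphic image of each standard fan. -/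
theorem isEpi_model_zero {l m n : ℕ} (g : model l m → model 0 n) : IsEpi g where
  continuous := continuous_of_discreteTopology
  surjective := fun x => ⟨default, Subsingleton.elim (g default) x⟩
  R_iff x y := ⟨fun _ => ⟨default, default, Subsingleton.elim (g default) x,
    Subsingleton.elim (g default) y, Or.inl rfl⟩, fun _ => Or.inl (Subsingleton.elim x y)⟩
  S_iff x y := ⟨fun _ => ⟨(pt 0 0 : Pt l m), (pt 0 0 : Pt l m), Subsingleton.elim (g _) x,
    Subsingleton.elim (g _) y, Or.inl lev_root⟩, fun _ => Or.inl (Nat.le_zero.1 (Pt.lev_le x))⟩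

theorem IsGenericLimit.isProjFraisseLimit {L : TopStructure.{u}} {N : ℕ → ℕ}
    {π : ∀ i, L → model (N i) (N i)} (hL : IsGenericLimit L N π) (h0 : N 0 = 1) :
    IsProjFraisseLimit orderedFans L where
  universal A hA := by
    obtain ⟨k, n, E, hn, -, hE⟩ := exists_isEpi_equiv_model hA
    suffices h : ∃ φ : L → model k n, IsEpi φ by
      obtain ⟨φ, hφ⟩ := h
      exact ⟨E.symm ∘ φ, hE.comp hφ⟩
    rcases Nat.eq_zero_or_pos k with rfl | hk
    · exact ⟨_, (isEpi_model_zero fun _ => (default : model 0 n)).comp (hL.isEpi 0)⟩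
    · obtain ⟨g, hg⟩ := exists_isPtEpi_of_le (k := N 0) (n := N 0) (hL.pos 0)
        (h0.le.trans hk) (h0.le.trans hn)
      obtain ⟨φ, hφ, -⟩ := hL.lift k n (N 0) (N 0) (hL.pos 0) (hL.pos 0) g (π 0) hg (hL.isEpi 0)
      exact ⟨φ, hφ⟩
  factor X _ _ _ f hf := by
    obtain ⟨i, f₀, h⟩ := hL.factor X f hf
    exact ⟨_, model_mem_orderedFans (hL.pos i) (hL.pos i), π i, hL.isEpi i, f₀, h⟩
  ultrahomogeneous A hA φ₁ φ₂ h₁ h₂ := by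
    obtain ⟨k, n, E, hn, hE, -⟩ := exists_isEpi_equiv_model hA
    rcases Nat.eq_zero_or_pos k with rfl | hk
    · exact ⟨id, ⟨isEpi_id L, Function.bijective_id⟩,
        funext fun x => E.injective (Subsingleton.elim _ _)⟩
    · obtain ⟨ψ, hψ, h⟩ := hL.exists_isIso hk hn (hE.comp h₁) (hE.comp h₂)
      exact ⟨ψ, hψ, funext fun x => E.injective (congrFun h x)⟩

theorem isStandardLimit_of_isProjFraisseLimit {L : TopStructure.{u}}
    (hL : IsProjFraisseLimit orderedFans L) : IsStandardLimit L where
  universal N hN := hL.universal _ (model_mem_orderedFans hN hN)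
  factor X _ _ _ f hf := by
    obtain ⟨φ₁, hφ₁⟩ := hL.universal _ (model_mem_orderedFans one_pos one_pos)
    -- The second component makes the fan through which the pair factors have positive height.
    obtain ⟨A, hA, φ, hφ, f₀, hf₀⟩ := hL.factor (X × model 1 1) (fun z => (f z, φ₁ z))
      (hf.prodMk hφ₁.continuous)
    obtain ⟨k, n, E, hn, hE, -⟩ := exists_isEpi_equiv_model hA
    refine ⟨k, Nat.pos_of_ne_zero ?_, n, hn, E ∘ φ, hE.comp hφ, fun y => (f₀ (E.symm y)).1, ?_⟩
    · rintro rfl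
      obtain ⟨x, y, hxy⟩ := nontrivial_model one_pos one_pos
      obtain ⟨x, rfl⟩ := hφ₁.surjective x
      obtain ⟨y, rfl⟩ := hφ₁.surjective y
      have h1 : φ x = φ y := E.injective (Subsingleton.elim _ _)
      have h2 := (congrFun hf₀ x).trans ((congrArg f₀ h1).trans (congrFun hf₀ y).symm)
      exact hxy (congrArg Prod.snd h2)
    · funext z
      simpa using congrArg Prod.fst (congrFun hf₀ z)
  ultrahomogeneous k hk n hn := hL.ultrahomogeneous _ (model_mem_orderedFans hk hn)

end Fan

theorem theorem2p9 :
    (∃ L : TopStructure.{u}, TopStructure.IsProjFraisseLimit Fan.orderedFans L) ∧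
    ∀ L : TopStructure.{u}, TopStructure.IsProjFraisseLimit Fan.orderedFans L →
      ExtremelyAmenable.{u, v} L.Aut := by
  obtain ⟨L, N, π, hL, h0⟩ := Fan.exists_isGenericLimit.{u}
  exact ⟨⟨L, hL.isProjFraisseLimit h0⟩,
    fun _ hL => (Fan.isStandardLimit_of_isProjFraisseLimit hL).extremelyAmenable⟩
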